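/- **Setting.** Let $A\in\mathbb C^{d\times d}$, $L=\frac{A+A^\dagger}{2}$, $H=\frac{A-A^\dagger}{2i}$, and assume $L\succeq 0$. Let $t>0$, $\beta\in(0,1)$, $\epsilon_{\rm trunc},\epsilon_{\rm disc}>0$, and let $\|L\|$ be the spectral norm. Put $C_\beta=2\pi e^{-2^\beta}$, $g(k)=\dfrac{1}{C_\beta(1-ik)e^{(1+ik)^\beta}}$ (principal power), $U(t,k)=e^{-it(kL+H)}$, $$B_\beta=\frac{2^{\lceil 1/\beta\rceil+1}\lceil 1/\beta\rceil!}{C_\beta\cos(\beta\pi/2)^{\lceil 1/\beta\rceil}},\qquad K=\left(\frac{2\beta}{\cos(\beta\pi/2)}W_0\!\left(\Big(\frac{B_\beta}{\epsilon_{\rm trunc}}\Big)^{1/\beta}\frac{\cos(\beta\pi/2)}{2\beta}\right)\right)^{1/\beta},$$ $$Q=\left\lceil-\frac{\log_2 e}{4}\,W_{-1}\!\left(\frac{-3C_\beta}{2\pi e^{1/3}\log_2 e}\,\frac{\epsilon_{\rm disc}}{K}\right)\right\rceil,$$ where $W_0,W_{-1}$ are the real branches of the Lambert function; assume that the argument of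 $W_{-1}$ is at least $-1/e$, so that $Q$ is defined. For $h>0$ with $K/h$ an integer let $$\mathcal L_h=\sum_{m=-K/h}^{K/h-1}\sum_{q=1}^{Q}c_{q,m}U(t,k_{q,m})=\sum_{j=1}^{M}c_je^{-it(k_jL+H)},\quad k_{q,m}=\tfrac h2\zeta_q+\tfrac{(2m+1)h}{2},\quad c_{q,m}=\tfrac h2\,\omega_q\,g(k_{q,m}),$$ where $\zeta_q,\omega_q$ are the nodes and weights of $Q$-point Gauss–Legendre quadrature on $[-1,1]$. Say that $h$ is *good* if the number of terms of $\mathcal L_h$ is $M=2KQ/h$, all $|k_j|\le K$, and for every $u_0\in\mathbb C^d$, every solution $u:\mathbb R\to\mathbb C^d$ of $u'=-Au$, $u(0)=u_0$, and every $\epsilon_v$ with $\|u_0\|(\epsilon_{\rm trunc}+\epsilon_{\rm disc})\le\epsilon_v$, the vector $v(t)=\mathcal L_hu_0$ satisfies $\|v(t)-u(t)\|\le\epsilon_v$. **Claim.** 1. Every $h>0$ with $K/h$ an integer, $h\le 1$ and $h\cdot e\,t\|L\|\le 1$ is good. (In particular $h=1/(et\|L\|)$, when $et\|L\|\ge1$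 and $K/h$ is an integer.) 2. If $t\|L\|\ge 1$ and $\epsilon_{\rm trunc}\le 1$, then there is a good $h>0$ (with $K/h$ an integer) for which $$M\le t\|L\|\,e\,K\,Q,$$ that is, $M\le t\|L\|e\left(\frac{2\beta}{\cos(\beta\pi/2)}W_0\big((\frac{B_\beta}{\epsilon_{\rm trunc}})^{1/\beta}\frac{\cos(\beta\pi/2)}{2\beta}\big)\right)^{1/\beta}\left\lceil-\frac{\log_2 e}{4}W_{-1}\big(\frac{-3C_\beta}{2\pi e^{1/3}\log_2 e}\frac{\epsilon_{\rm disc}}{K}\big)\right\rceil$ with $K$ as above. -/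

import Mathlib

open scoped ComplexOrder

noncomputable section

namespace LCHS

open Polynomial

/-! ### Lambert `W` -/

/-- The principal real branch of the Lambert function: for `x ≥ -1/e`,
the unique `y ≥ -1` with `y * exp y = x`. -/
def lambertW0 (x : ℝ) : ℝ :=
  Function.invFunOn (fun y : ℝ => y * Real.exp y) (Set.Ici (-1)) x

/-- The branch `W₋₁` of the Lambert function: for `-1/e ≤ x < 0`,
the unique `y ≤ -1` with `y * exp y = x`. -/
def lambertWm1 (x : ℝ) : ℝ :=
  Function.invFunOn (fun y : ℝ => y * Real.exp y) (Set.Iic (-1)) x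

/-! ### The kernel and the parameters `K` and `Q` -/

/-- `C_β = 2π exp(-2^β)`. -/
def Cβ (β : ℝ) : ℝ := 2 * Real.pi * Real.exp (-((2 : ℝ) ^ β))

/-- The kernel `g(k) = 1 / (C_β (1 - i k) exp((1 + i k)^β))`, with the principal power. -/
def kernel (β k : ℝ) : ℂ :=
  1 / ((Cβ β : ℂ) * (1 - Complex.I * k) * Complex.exp ((1 + Complex.I * k) ^ (β : ℂ)))

/-- `B_β = 2^(⌈1/β⌉+1) ⌈1/β⌉! / (C_β cos(βπ/2)^⌈1/β⌉)`. -/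
def Bβ (β : ℝ) : ℝ :=
  (2 : ℝ) ^ (⌈1 / β⌉₊ + 1) * (Nat.factorial ⌈1 / β⌉₊ : ℝ)
    / (Cβ β * Real.cos (β * Real.pi / 2) ^ ⌈1 / β⌉₊)

/-- The truncation level
`K = ((2β / cos(βπ/2)) W₀((B_β/ε)^(1/β) cos(βπ/2)/(2β)))^(1/β)`. -/
def truncLevel (β εtrunc : ℝ) : ℝ :=
  (2 * β / Real.cos (β * Real.pi / 2)
    * lambertW0 ((Bβ β / εtrunc) ^ (1 / β) * (Real.cos (β * Real.pi / 2) / (2 * β)))) ^ (1 / β)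

/-- `log₂ e`. -/
def log2e : ℝ := Real.logb 2 (Real.exp 1)

/-- The argument `(-3 C_β / (2π e^(1/3) log₂ e)) (ε / K)` at which `W₋₁` is evaluated. -/
def quadArg (β K εdisc : ℝ) : ℝ :=
  -3 * Cβ β / (2 * Real.pi * Real.exp (1 / 3) * log2e) * (εdisc / K)

/-- The number of quadrature points per panel, `Q = ⌈-(log₂ e / 4) W₋₁(quadArg)⌉`. -/
def quadPoints (β K εdisc : ℝ) : ℕ :=
  ⌈-(log2e / 4) * lambertWm1 (quadArg β K εdisc)⌉₊

/-! ### Gauss-Legendre quadrature on `[-1, 1]` -/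

/-- The Legendre polynomial of degree `Q` (Rodrigues' formula). -/
def legendre (Q : ℕ) : ℝ[X] :=
  C (1 / ((2 : ℝ) ^ Q * (Nat.factorial Q : ℝ))) * derivative^[Q] ((X ^ 2 - 1) ^ Q)

/-- The Gauss nodes: the zeros of the Legendre polynomial of degree `Q`. -/
def gaussNodes (Q : ℕ) : Finset ℝ := (legendre Q).roots.toFinset

/-- The Gauss weight of the node `ζ`: the integral over `[-1, 1]` of the Lagrange basis
polynomial that is `1` at `ζ` and `0` at the other nodes. -/
def gaussWeight (Q : ℕ) (ζ : ℝ) : ℝ :=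
  ∫ x in (-1 : ℝ)..1, (Lagrange.basis (gaussNodes Q) id ζ).eval x

/-! ### The matrices and the discretized integrator -/

/-- `L = (A + A†) / 2`. -/
def hermPart {d : ℕ} (A : Matrix (Fin d) (Fin d) ℂ) : Matrix (Fin d) (Fin d) ℂ :=
  (1 / 2 : ℂ) • (A + A.conjTranspose)

/-- `H = (A - A†) / (2 i)`. -/
def skewPart {d : ℕ} (A : Matrix (Fin d) (Fin d) ℂ) : Matrix (Fin d) (Fin d) ℂ :=
  (1 / (2 * Complex.I) : ℂ) • (A - A.conjTranspose)

/-- The action of a matrix as an operator on `ℂ^d` with the Euclidean norm. -/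
def op {d : ℕ} (A : Matrix (Fin d) (Fin d) ℂ) :
    EuclideanSpace ℂ (Fin d) →L[ℂ] EuclideanSpace ℂ (Fin d) :=
  Matrix.toEuclideanCLM (n := Fin d) (𝕜 := ℂ) A

/-- `U(t, k) = exp(-i t (k L + H))`. -/
def evol {d : ℕ} (A : Matrix (Fin d) (Fin d) ℂ) (t k : ℝ) : Matrix (Fin d) (Fin d) ℂ :=
  NormedSpace.exp ((-(Complex.I * (t : ℂ))) • ((k : ℂ) • hermPart A + skewPart A))

/-- The index set of the terms of the discretized integral over `[-n h, n h]`: pairs of a panel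
`[m h, (m + 1) h]`, `-n ≤ m ≤ n - 1`, and a Gauss node. -/
def terms (n Q : ℕ) : Finset (ℤ × ℝ) := Finset.Ico (-(n : ℤ)) (n : ℤ) ×ˢ gaussNodes Q

/-- The quadrature point: the Gauss node transported to the panel `[m h, (m + 1) h]`. -/
def point (h : ℝ) (j : ℤ × ℝ) : ℝ := h / 2 * j.2 + (2 * (j.1 : ℝ) + 1) * h / 2

/-- The quadrature coefficient: rescaled Gauss weight times the kernel at the point. -/
def coeff (β h : ℝ) (Q : ℕ) (j : ℤ × ℝ) : ℂ :=
  ((h / 2 * gaussWeight Q j.2 : ℝ) : ℂ) * kernel β (point h j)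

/-- The discretized LCHS operator `∑_j c_j exp(-i t (k_j L + H))`, over `2 n` panels of length `h`
with `Q` Gauss nodes each. -/
def integrator {d : ℕ} (A : Matrix (Fin d) (Fin d) ℂ) (t β h : ℝ) (n Q : ℕ) :
    Matrix (Fin d) (Fin d) ℂ :=
  ∑ j ∈ terms n Q, coeff β h Q j • evol A t (point h j)

end LCHS

end

/-! Write `l = t‖L‖`, `c = cos(βπ/2)` and `f(k) = g(k) e^{-it(kL+H)} u₀`. The proof represents
`u(t)` exactly as an integral of `f`, then bounds a truncation error and a quadrature error.

Representation (`integral_integrand`). Since `Re⟨x, -it(zL+H)x⟩ = t Im z ⟨x, Lx⟩` and `L ≥ 0`, the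
propagator is a contraction for `Im z ≤ 0`. There the numerator of `g` is holomorphic and tends to
zero, so the only singularity of `f` is the pole at `z = -i`, where the generator is `-t(L+iH) =
-tA`. The constant `C_β` normalises the resulting value to `e^{-tA}u₀`.

Truncation (`truncation_error`). On the real line `|g(k)| ≤ e^{-c|k|^β}/(C_β|k|)`. Half of the
exponent buys a further factor `1/|k|`, and the other half stays as `e^{-cK^β/2}`. The equation
behind `W₀` makes the two tails together at most `ε_trunc ‖u₀‖`.

Quadrature (`composite_error`). Hermite interpolation at the Gauss nodes reduces the error to a
derivative of order `2Q`, and Cauchy's estimate on discs of radius `hs < 1` about real points bounds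
that derivative. On such discs `|g| ≤ e^{-1}/(C_β(1-hs))` and the propagator is at most `e^{lhs}`.
The definition of `Q` through `W₋₁` absorbs the factor `Q/16^Q`. Both claims then reduce to one
scalar inequality in `h`, `s`, `Q` (hypothesis `hX` of `integrator_error`).

Claim 1 takes `s = 2Q/(2Q+1)`. Claim 2 does not follow from it: `M = 2KQ/h ≤ l e K Q` forces `h ≥
2/(el)`, twice the step of claim 1. There `s = 1` works as soon as `lh ≤ 0.8`, and since `2/e ≈
0.736` this leaves room to round the number of panels, provided `K` is not small;
`nine_le_truncLevel` gives `K ≥ 9`. -/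

noncomputable section

namespace LCHS

open Polynomial

/-! ### A generalized Rolle theorem -/

/-- Between `m + 1` zeros of `f` there are `m` zeros of `f'`, different from the given ones. -/
theorem exists_finset_zeros_deriv {f f' : ℝ → ℝ} (hf : ∀ x, HasDerivAt f (f' x) x)
    {a b : ℝ} (s : Finset ℝ) (hs : ∀ x ∈ s, x ∈ Set.Icc a b ∧ f x = 0) :
    ∃ t : Finset ℝ, Disjoint t s ∧ s.card ≤ t.card + 1 ∧
      ∀ x ∈ t, x ∈ Set.Icc a b ∧ f' x = 0 := by
  classical
  have key : ∀ p : ℝ × ℝ, ∃ z, p.1 < p.2 → p.1 ∈ s → p.2 ∈ s →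
      z ∈ Set.Ioo p.1 p.2 ∧ f' z = 0 := by
    intro p
    by_cases h : p.1 < p.2 ∧ p.1 ∈ s ∧ p.2 ∈ s
    · obtain ⟨z, hz, hz'⟩ := exists_hasDerivAt_eq_zero (f := f) (f' := f') h.1
        (fun x _ => (hf x).continuousAt.continuousWithinAt)
        ((hs _ h.2.1).2.trans (hs _ h.2.2).2.symm) (fun x _ => hf x)
      exact ⟨z, fun _ _ _ => ⟨hz, hz'⟩⟩
    · exact ⟨0, fun h1 h2 h3 => absurd ⟨h1, h2, h3⟩ h⟩
  choose c hc using key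
  let t : Finset ℝ := ((s ×ˢ s).filter fun p => p.1 < p.2).image c
  refine ⟨t \ s, Finset.sdiff_disjoint, ?_, ?_⟩
  · refine Finset.card_le_sdiff_of_interleaved fun x hx y hy hxy _ => ?_
    have h := hc (x, y) hxy hx hy
    exact ⟨c (x, y), Finset.mem_image.2 ⟨(x, y), by simp [hx, hy, hxy], rfl⟩, h.1.1, h.1.2⟩
  · intro x hx
    obtain ⟨p, hp, rfl⟩ := Finset.mem_image.1 (Finset.mem_sdiff.1 hx).1
    simp only [Finset.mem_filter, Finset.mem_product] at hp
    obtain ⟨h1, h2⟩ := hc p hp.2 hp.1.1 hp.1.2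
    exact ⟨⟨(hs _ hp.1.1).1.1.trans h1.1.le, h1.2.le.trans (hs _ hp.1.2).1.2⟩, h2⟩

theorem exists_zero_iterated_deriv {a b : ℝ} (n : ℕ) :
    ∀ (F : ℕ → ℝ → ℝ), (∀ j x, HasDerivAt (F j) (F (j + 1) x) x) →
      ∀ s : Finset ℝ, (∀ x ∈ s, x ∈ Set.Icc a b ∧ F 0 x = 0) → n + 1 ≤ s.card →
        ∃ ξ ∈ Set.Icc a b, F n ξ = 0 := by
  induction n with
  | zero =>
    intro F _ s hs hcard
    obtain ⟨x, hx⟩ := Finset.card_pos.1 (by omega : 0 < s.card)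
    exact ⟨x, (hs x hx).1, (hs x hx).2⟩
  | succ n ih =>
    intro F hF s hs hcard
    obtain ⟨t, -, hc, ht⟩ := exists_finset_zeros_deriv (hF 0) s hs
    exact ih (fun j => F (j + 1)) (fun j => hF (j + 1)) t ht (by omega)

/-! ### Integrals of polynomials over `[-1, 1]` -/

theorem integral_eval_derivative (p : ℝ[X]) :
    ∫ x in (-1 : ℝ)..1, (derivative p).eval x = p.eval 1 - p.eval (-1) :=
  intervalIntegral.integral_eq_sub_of_hasDerivAt (fun x _ => p.hasDerivAt x)
    ((derivative p).continuous.intervalIntegrable _ _)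

theorem eval_intervalIntegrable (p : ℝ[X]) (a b : ℝ) :
    IntervalIntegrable (fun x => p.eval x) MeasureTheory.volume a b :=
  p.continuous.intervalIntegrable _ _

theorem integral_derivative_mul (p q : ℝ[X]) (h1 : p.eval 1 = 0) (h2 : p.eval (-1) = 0) :
    ∫ x in (-1 : ℝ)..1, (derivative p * q).eval x
      = -∫ x in (-1 : ℝ)..1, (p * derivative q).eval x := by
  have h := integral_eval_derivative (p * q)
  rw [derivative_mul] at h
  simp only [eval_add] at h
  rw [intervalIntegral.integral_add (eval_intervalIntegrable _ _ _)
    (eval_intervalIntegrable _ _ _)] at h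
  simp only [eval_mul, h1, h2, zero_mul, sub_zero] at h ⊢
  linarith

theorem iterate_derivative_eq_C {n : ℕ} {p : ℝ[X]} (hp : p.natDegree ≤ n) :
    derivative^[n] p = C ((n.factorial : ℝ) * p.coeff n) := by
  have h : (derivative^[n] p).natDegree = 0 := by
    have := natDegree_iterate_derivative p n
    omega
  rw [eq_C_of_natDegree_eq_zero h, coeff_iterate_derivative]
  simp [Nat.descFactorial_self]

/-- The polynomial `(X ^ 2 - 1) ^ Q`, whose `Q`-th derivative is proportional to the Legendre
polynomial. -/
def bump (Q : ℕ) : ℝ[X] := (X ^ 2 - 1) ^ Q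

theorem monic_sq_sub_one : (X ^ 2 - 1 : ℝ[X]).Monic := by
  simpa using monic_X_pow_sub_C (1 : ℝ) two_ne_zero

theorem natDegree_sq_sub_one : (X ^ 2 - 1 : ℝ[X]).natDegree = 2 := by
  simpa using natDegree_X_pow_sub_C (n := 2) (r := (1 : ℝ))

theorem monic_bump (Q : ℕ) : (bump Q).Monic := monic_sq_sub_one.pow Q

theorem natDegree_bump (Q : ℕ) : (bump Q).natDegree = 2 * Q := by
  rw [bump, monic_sq_sub_one.natDegree_pow, natDegree_sq_sub_one, mul_comm]

theorem eval_iterate_derivative_bump {Q k : ℕ} (hk : k < Q) {x : ℝ} (hx : x ^ 2 = 1) :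
    (derivative^[k] (bump Q)).eval x = 0 := by
  obtain ⟨r, hr⟩ := pow_sub_dvd_iterate_derivative_pow (X ^ 2 - 1 : ℝ[X]) Q k
  rw [bump, hr, eval_mul, eval_pow]
  simp [hx, Nat.sub_ne_zero_of_lt hk]

/-- Repeated integration by parts; derivatives of `(X² - 1)^Q` of order below `Q` vanish at `±1`, so
no boundary term survives. -/
theorem integral_iterate_derivative_bump_mul (Q : ℕ) (q : ℝ[X]) {k : ℕ} (hk : k ≤ Q) :
    ∫ x in (-1 : ℝ)..1, (derivative^[Q] (bump Q) * q).eval x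
      = (-1) ^ k * ∫ x in (-1 : ℝ)..1,
        (derivative^[Q - k] (bump Q) * derivative^[k] q).eval x := by
  induction k with
  | zero => simp
  | succ k ih =>
    rw [ih (by omega), show Q - k = (Q - (k + 1)) + 1 by omega, Function.iterate_succ_apply',
      integral_derivative_mul, ← Function.iterate_succ_apply' derivative k q, pow_succ]
    · ring
    · exact eval_iterate_derivative_bump (by omega) (by norm_num)
    · exact eval_iterate_derivative_bump (by omega) (by norm_num)

theorem integral_iterate_derivative_bump_mul_eq_zero {Q : ℕ} {q : ℝ[X]} (hq : q.degree < Q) :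
    ∫ x in (-1 : ℝ)..1, (derivative^[Q] (bump Q) * q).eval x = 0 := by
  rw [integral_iterate_derivative_bump_mul Q q le_rfl,
    iterate_derivative_eq_zero_of_degree_lt hq]
  simp

/-- The difference of the two integrands is the derivative of `x(1 - x²)^(Q+1)`, which vanishes at
`±1`. -/
theorem integral_bump_recursion (Q : ℕ) :
    (2 * (Q : ℝ) + 3) * ∫ x in (-1 : ℝ)..1, (1 - x ^ 2) ^ (Q + 1)
      = 2 * (Q + 1) * ∫ x in (-1 : ℝ)..1, (1 - x ^ 2) ^ Q := by
  have h : ∫ x in (-1 : ℝ)..1, ((2 * (Q : ℝ) + 3) * (1 - x ^ 2) ^ (Q + 1)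
      - 2 * (Q + 1) * (1 - x ^ 2) ^ Q) = 0 := by
    rw [intervalIntegral.integral_eq_sub_of_hasDerivAt
      (f := fun x : ℝ => x * (1 - x ^ 2) ^ (Q + 1))]
    · norm_num
    · intro x _
      have h1 : HasDerivAt (fun x : ℝ => 1 - x ^ 2) (-(2 * x)) x := by
        simpa using ((hasDerivAt_pow 2 x).const_sub 1)
      have h2 := (hasDerivAt_id' x).fun_mul (h1.fun_pow (Q + 1))
      refine h2.congr_deriv ?_
      rw [Nat.add_sub_cancel]
      push_cast
      ring
    · exact Continuous.intervalIntegrable (by fun_prop) _ _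
  rw [intervalIntegral.integral_sub (Continuous.intervalIntegrable (by fun_prop) _ _)
    (Continuous.intervalIntegrable (by fun_prop) _ _), intervalIntegral.integral_const_mul,
    intervalIntegral.integral_const_mul] at h
  linarith

theorem integral_one_sub_sq_pow (Q : ℕ) :
    (2 * (Q : ℝ) + 1) * Nat.centralBinom Q * ∫ x in (-1 : ℝ)..1, (1 - x ^ 2) ^ Q
      = 2 * 4 ^ Q := by
  induction Q with
  | zero => norm_num
  | succ Q ih =>
    have h1 := integral_bump_recursion Q
    have h2 : ((Q : ℝ) + 1) * Nat.centralBinom (Q + 1)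
        = 2 * (2 * Q + 1) * Nat.centralBinom Q := by
      exact_mod_cast Nat.succ_mul_centralBinom_succ Q
    set J := ∫ x in (-1 : ℝ)..1, (1 - x ^ 2) ^ Q
    set J' := ∫ x in (-1 : ℝ)..1, (1 - x ^ 2) ^ (Q + 1)
    have h3 : ((Q : ℝ) + 1) ≠ 0 := by positivity
    apply mul_left_cancel₀ h3
    calc ((Q : ℝ) + 1) * ((2 * ((Q + 1 : ℕ) : ℝ) + 1) * (Nat.centralBinom (Q + 1)) * J')
        = ((Q + 1) * (Nat.centralBinom (Q + 1))) * ((2 * (Q : ℝ) + 3) * J') := by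
          push_cast; ring
      _ = (Q + 1) * 4 * ((2 * (Q : ℝ) + 1) * (Nat.centralBinom Q) * J) := by rw [h1, h2]; ring
      _ = _ := by rw [ih]; ring

/-- Equivalent to `centralBinom Q ≥ 4^Q / (2√Q)`; it turns the exact norm of the monic Legendre
polynomial into the bound of `integral_node_sq_le`. -/
theorem sixteen_pow_le {Q : ℕ} (hQ : 1 ≤ Q) :
    (16 : ℝ) ^ Q ≤ 4 * Q * (Nat.centralBinom Q : ℝ) ^ 2 := by
  induction Q, hQ using Nat.le_induction with
  | base => norm_num [Nat.centralBinom]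
  | succ Q hQ ih =>
    have h2 : ((Q : ℝ) + 1) * Nat.centralBinom (Q + 1)
        = 2 * (2 * Q + 1) * Nat.centralBinom Q := by
      exact_mod_cast Nat.succ_mul_centralBinom_succ Q
    have h3 : 0 < ((Q : ℝ) + 1) := by positivity
    refine le_of_mul_le_mul_left ?_ h3
    calc ((Q : ℝ) + 1) * 16 ^ (Q + 1) = 16 * (Q + 1) * 16 ^ Q := by ring
      _ ≤ 16 * (Q + 1) * (4 * Q * (Nat.centralBinom Q : ℝ) ^ 2) := by gcongr
      _ = 16 * (4 * Q * (Q + 1)) * (Nat.centralBinom Q : ℝ) ^ 2 := by ring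
      _ ≤ 16 * (2 * Q + 1) ^ 2 * (Nat.centralBinom Q : ℝ) ^ 2 := by gcongr; nlinarith
      _ = 4 * (2 * (2 * Q + 1) * Nat.centralBinom Q) ^ 2 := by ring
      _ = 4 * (((Q : ℝ) + 1) * Nat.centralBinom (Q + 1)) ^ 2 := by rw [h2]
      _ = _ := by push_cast; ring

/-! ### The Gauss nodes -/

theorem legendre_eq (Q : ℕ) :
    legendre Q = C (1 / ((2 : ℝ) ^ Q * (Nat.factorial Q : ℝ))) * derivative^[Q] (bump Q) := rfl

theorem legendre_const_ne_zero (Q : ℕ) : 1 / ((2 : ℝ) ^ Q * (Nat.factorial Q : ℝ)) ≠ 0 := by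
  positivity

theorem gaussNodes_eq (Q : ℕ) : gaussNodes Q = (derivative^[Q] (bump Q)).roots.toFinset := by
  rw [gaussNodes, legendre_eq, roots_C_mul _ (legendre_const_ne_zero Q)]

theorem iterate_derivative_bump_ne_zero {Q k : ℕ} (hk : k ≤ 2 * Q) :
    derivative^[k] (bump Q) ≠ 0 := by
  intro h
  have h1 : derivative^[2 * Q - k] (derivative^[k] (bump Q)) = 0 := by
    rw [h, iterate_derivative_zero]
  rw [← Function.iterate_add_apply, Nat.sub_add_cancel hk,
    iterate_derivative_eq_C (natDegree_bump Q).le, ← natDegree_bump Q,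
    coeff_natDegree, (monic_bump Q)] at h1
  simp [Nat.factorial_ne_zero] at h1

/-- Each derivative gains one root: Rolle puts `k + 1` new roots between `k + 2` old ones, and `±1`,
being among the old roots, are still roots and are counted separately. -/
theorem card_roots_iterate_derivative_bump {Q k : ℕ} (hk : k < Q) :
    k + 2 ≤ (derivative^[k] (bump Q)).roots.toFinset.card := by
  have hmem : ∀ {k : ℕ}, k < Q → ∀ x : ℝ, x ^ 2 = 1 →
      x ∈ (derivative^[k] (bump Q)).roots.toFinset := fun {k} hk x hx => by
    rw [Multiset.mem_toFinset, mem_roots (iterate_derivative_bump_ne_zero (by omega))]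
    exact eval_iterate_derivative_bump hk hx
  have hpair : ({1, -1} : Finset ℝ).card = 2 := Finset.card_pair (by norm_num)
  induction k with
  | zero =>
    rw [zero_add, ← hpair]
    refine Finset.card_le_card fun x hx => hmem hk x ?_
    simp only [Finset.mem_insert, Finset.mem_singleton] at hx
    rcases hx with rfl | rfl <;> norm_num
  | succ k ih =>
    have h1 := ih (by omega)
    have h2 := card_roots_toFinset_le_card_roots_derivative_sdiff_roots_succ
      (derivative^[k] (bump Q))
    rw [← Function.iterate_succ_apply' derivative k (bump Q)] at h2
    set R := (derivative^[k] (bump Q)).roots.toFinset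
    set R' := (derivative^[k + 1] (bump Q)).roots.toFinset
    have hsub : (R' \ R) ∪ {1, -1} ⊆ R' := by
      refine Finset.union_subset Finset.sdiff_subset fun x hx => hmem hk x ?_
      simp only [Finset.mem_insert, Finset.mem_singleton] at hx
      rcases hx with rfl | rfl <;> norm_num
    have hdisj : Disjoint (R' \ R) {1, -1} := by
      refine Finset.disjoint_left.2 fun x hx hx' => (Finset.mem_sdiff.1 hx).2 ?_
      refine hmem (by omega) x ?_
      simp only [Finset.mem_insert, Finset.mem_singleton] at hx'
      rcases hx' with rfl | rfl <;> norm_num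
    have h3 := Finset.card_le_card hsub
    rw [Finset.card_union_of_disjoint hdisj, hpair] at h3
    omega

theorem natDegree_iterate_derivative_bump_le (Q : ℕ) :
    (derivative^[Q] (bump Q)).natDegree ≤ Q := by
  have := natDegree_iterate_derivative (bump Q) Q
  rw [natDegree_bump] at this
  omega

theorem card_gaussNodes {Q : ℕ} (hQ : 1 ≤ Q) : (gaussNodes Q).card = Q := by
  apply le_antisymm
  · rw [gaussNodes_eq]
    exact (Multiset.toFinset_card_le _).trans ((card_roots' _).trans
      (natDegree_iterate_derivative_bump_le Q))
  · have h1 := card_roots_iterate_derivative_bump (show Q - 1 < Q by omega)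
    have h2 := card_roots_toFinset_le_card_roots_derivative_sdiff_roots_succ
      (derivative^[Q - 1] (bump Q))
    rw [← Function.iterate_succ_apply' derivative (Q - 1) (bump Q), Nat.succ_eq_add_one,
      Nat.sub_add_cancel hQ, ← gaussNodes_eq] at h2
    have h3 := Finset.card_le_card (Finset.sdiff_subset (s := gaussNodes Q)
      (t := (derivative^[Q - 1] (bump Q)).roots.toFinset))
    omega

/-- The monic Legendre polynomial. -/
abbrev node (Q : ℕ) : ℝ[X] := Lagrange.nodal (gaussNodes Q) id

theorem iterate_derivative_bump_eq {Q : ℕ} (hQ : 1 ≤ Q) :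
    derivative^[Q] (bump Q) = C ((Nat.factorial (2 * Q) : ℝ) / Nat.factorial Q) * node Q := by
  set P := derivative^[Q] (bump Q) with hP
  have hcoeff : P.coeff Q = (Nat.factorial (2 * Q) : ℝ) / Nat.factorial Q := by
    rw [hP, coeff_iterate_derivative, ← two_mul]
    have : (bump Q).coeff (2 * Q) = 1 := by
      rw [← natDegree_bump Q, coeff_natDegree, (monic_bump Q)]
    rw [this, eq_div_iff (by positivity), nsmul_eq_mul, mul_one]
    have h := Nat.factorial_mul_descFactorial (show Q ≤ 2 * Q by omega)
    rw [show 2 * Q - Q = Q by omega] at h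
    exact_mod_cast (by rw [mul_comm]; exact h)
  have hdeg : P.natDegree = Q := by
    refine le_antisymm (natDegree_iterate_derivative_bump_le Q) (le_natDegree_of_ne_zero ?_)
    rw [hcoeff]
    positivity
  have hcard := card_gaussNodes hQ
  have h1 : Multiset.card P.roots = P.natDegree := by
    refine le_antisymm (card_roots' _) ?_
    rw [hdeg, ← hcard, gaussNodes_eq]
    exact Multiset.toFinset_card_le _
  have hnodup : P.roots.Nodup := by
    rw [← Multiset.toFinset_card_eq_card_iff_nodup, h1, hdeg, ← hcard, gaussNodes_eq]
  have h2 := C_leadingCoeff_mul_prod_multiset_X_sub_C h1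
  rw [leadingCoeff, hdeg, hcoeff] at h2
  rw [← h2, node, Lagrange.nodal, gaussNodes_eq]
  congr 1
  rw [Finset.prod, Multiset.toFinset_val, hnodup.dedup]
  rfl

theorem integral_node_mul_eq_zero {Q : ℕ} (hQ : 1 ≤ Q) {q : ℝ[X]} (hq : q.degree < Q) :
    ∫ x in (-1 : ℝ)..1, (node Q * q).eval x = 0 := by
  have h := integral_iterate_derivative_bump_mul_eq_zero hq
  rw [iterate_derivative_bump_eq hQ] at h
  simp only [mul_assoc, eval_mul, eval_C] at h ⊢
  rw [intervalIntegral.integral_const_mul] at h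
  exact (mul_eq_zero.1 h).resolve_left (by positivity)

theorem degree_node {Q : ℕ} (hQ : 1 ≤ Q) : (node Q).degree = Q := by
  rw [node, Lagrange.degree_nodal, card_gaussNodes hQ]

/-- By Rodrigues' formula and `Q` integrations by parts, the norm becomes a multiple of `∫ (1 -
x²)^Q`, which is known in closed form. -/
theorem integral_node_sq {Q : ℕ} (hQ : 1 ≤ Q) :
    ∫ x in (-1 : ℝ)..1, ((node Q).eval x) ^ 2
      = 2 * 4 ^ Q / ((2 * Q + 1) * (Nat.centralBinom Q : ℝ) ^ 2) := by
  have h := integral_iterate_derivative_bump_mul Q (derivative^[Q] (bump Q)) le_rfl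
  rw [← Function.iterate_add_apply, ← two_mul, iterate_derivative_eq_C (natDegree_bump Q).le,
    show (bump Q).coeff (2 * Q) = 1 by
      rw [← natDegree_bump Q, coeff_natDegree, (monic_bump Q)], Nat.sub_self,
    Function.iterate_zero_apply, iterate_derivative_bump_eq hQ] at h
  simp only [eval_mul, eval_C, mul_one, bump, eval_pow, eval_sub, eval_X, eval_one] at h
  rw [intervalIntegral.integral_mul_const] at h
  have e1 : ∀ x : ℝ, (Nat.factorial (2 * Q) : ℝ) / Nat.factorial Q * (node Q).eval x
      * ((Nat.factorial (2 * Q) : ℝ) / Nat.factorial Q * (node Q).eval x)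
      = ((Nat.factorial (2 * Q) : ℝ) / Nat.factorial Q) ^ 2 * ((node Q).eval x) ^ 2 := by
    intro x; ring
  have e2 : ∀ x : ℝ, (x ^ 2 - 1) ^ Q = (-1) ^ Q * (1 - x ^ 2) ^ Q := by
    intro x; rw [← mul_pow]; ring
  simp only [e1, e2, intervalIntegral.integral_const_mul] at h
  rw [← mul_assoc, ← mul_assoc, ← mul_pow] at h
  norm_num at h
  have hJ := integral_one_sub_sq_pow Q
  have hcb : (Nat.centralBinom Q : ℝ) * (Nat.factorial Q : ℝ) ^ 2 = Nat.factorial (2 * Q) := by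
    have := Nat.choose_mul_factorial_mul_factorial (show Q ≤ 2 * Q by omega)
    rw [show 2 * Q - Q = Q by omega] at this
    rw [Nat.centralBinom]
    exact_mod_cast (by rw [sq, ← mul_assoc]; exact this)
  rw [← hcb] at h
  have hf : (Nat.factorial Q : ℝ) ≠ 0 := by positivity
  have hc0 : (Nat.centralBinom Q : ℝ) ≠ 0 := by exact_mod_cast (Nat.centralBinom_ne_zero Q)
  rw [eq_div_iff (by positivity)]
  set N := ∫ x in (-1 : ℝ)..1, ((node Q).eval x) ^ 2
  set J := ∫ x in (-1 : ℝ)..1, (1 - x ^ 2) ^ Q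
  have h4 : (Nat.centralBinom Q : ℝ) * N = J := by
    field_simp at h
    exact h
  rw [← hJ, ← h4]
  ring

theorem integral_node_sq_le {Q : ℕ} (hQ : 1 ≤ Q) :
    ∫ x in (-1 : ℝ)..1, ((node Q).eval x) ^ 2 ≤ 8 * Q / ((2 * Q + 1) * 4 ^ Q) := by
  rw [integral_node_sq hQ]
  have h := sixteen_pow_le hQ
  have hc0 : 0 < (Nat.centralBinom Q : ℝ) := by exact_mod_cast (Nat.centralBinom_pos Q)
  rw [div_le_div_iff₀ (by positivity) (by positivity)]
  have e : (16 : ℝ) ^ Q = 4 ^ Q * 4 ^ Q := by rw [← mul_pow]; norm_num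
  rw [e] at h
  calc 2 * 4 ^ Q * ((2 * Q + 1) * 4 ^ Q) = 2 * (2 * Q + 1) * ((4 : ℝ) ^ Q * 4 ^ Q) := by ring
    _ ≤ 2 * (2 * Q + 1) * (4 * Q * (Nat.centralBinom Q : ℝ) ^ 2) := by gcongr
    _ = _ := by ring

/-- If a node `ζ` lay outside, the cofactor `q = node/(X - ζ)` would have degree below `Q`, so
orthogonality would give `∫ (x - ζ) q² = 0`, although this integrand has constant sign and is not
identically zero. -/
theorem gaussNodes_subset {Q : ℕ} (hQ : 1 ≤ Q) {ζ : ℝ} (hζ : ζ ∈ gaussNodes Q) :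
    ζ ∈ Set.Ioo (-1 : ℝ) 1 := by
  classical
  set q := Lagrange.nodal ((gaussNodes Q).erase ζ) (id : ℝ → ℝ) with hq
  have hfac : node Q = (X - C ζ) * q := by
    have := Lagrange.nodal_eq_mul_nodal_erase (v := (id : ℝ → ℝ)) hζ
    simpa using this
  have hqdeg : q.degree < Q := by
    rw [hq, Lagrange.degree_nodal, Finset.card_erase_of_mem hζ, card_gaussNodes hQ]
    exact_mod_cast (by omega)
  have hint : ∫ x in (-1 : ℝ)..1, (x - ζ) * (q.eval x) ^ 2 = 0 := by
    have := integral_node_mul_eq_zero hQ hqdeg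
    rw [hfac] at this
    simp only [eval_mul, eval_sub, eval_X, eval_C] at this
    rw [← this]
    exact intervalIntegral.integral_congr fun x _ => by ring
  have hcont : Continuous fun x => (x - ζ) * (q.eval x) ^ 2 := by fun_prop
  have hfin : {x : ℝ | q.eval x = 0}.Finite := by
    have : q ≠ 0 := Lagrange.nodal_ne_zero
    refine (q.roots.toFinset.finite_toSet).subset fun x hx => ?_
    simp only [Finset.mem_coe, Multiset.mem_toFinset]
    exact (mem_roots this).2 hx
  obtain ⟨y, hy, hy0⟩ : ∃ y ∈ Set.Ioo (-1 : ℝ) 1, q.eval y ≠ 0 := by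
    by_contra! hcon
    exact (Set.Ioo_infinite (by norm_num : (-1 : ℝ) < 1)) (hfin.subset fun x hx => hcon x hx)
  by_contra hout
  rw [Set.mem_Ioo, not_and_or, not_lt, not_lt] at hout
  rcases hout with h | h
  · have hpos := intervalIntegral.integral_pos (a := -1) (b := 1) (by norm_num)
      hcont.continuousOn (fun x hx => mul_nonneg (by linarith [hx.1]) (sq_nonneg _))
      ⟨y, ⟨hy.1.le, hy.2.le⟩, mul_pos (by linarith [hy.1]) (by positivity)⟩
    linarith
  · have hpos := intervalIntegral.integral_pos (a := -1) (b := 1) (by norm_num)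
      hcont.neg.continuousOn
      (fun x hx => by
        have := mul_nonneg (show 0 ≤ ζ - x by linarith [hx.2]) (sq_nonneg (q.eval x))
        simp only [Pi.neg_apply]; nlinarith)
      ⟨y, ⟨hy.1.le, hy.2.le⟩, by
        have := mul_pos (show 0 < ζ - y by linarith [hy.2])
          (show 0 < (q.eval y) ^ 2 by positivity)
        simp only [Pi.neg_apply]; nlinarith⟩
    simp only [Pi.neg_apply, intervalIntegral.integral_neg] at hpos
    linarith

/-! ### Exactness and the error of Gauss quadrature -/

theorem sum_gaussWeight_interpolate (Q : ℕ) (r : ℝ → ℝ) :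
    ∑ ζ ∈ gaussNodes Q, gaussWeight Q ζ * r ζ
      = ∫ x in (-1 : ℝ)..1, (Lagrange.interpolate (gaussNodes Q) id r).eval x := by
  simp only [Lagrange.interpolate_apply, eval_finsetSum, eval_mul, eval_C]
  rw [intervalIntegral.integral_finsetSum fun i _ =>
    Continuous.intervalIntegrable (by fun_prop) _ _]
  refine Finset.sum_congr rfl fun ζ _ => ?_
  rw [intervalIntegral.integral_const_mul, gaussWeight, mul_comm]

/-- A polynomial of degree less than `2 Q` interpolating values and derivatives at the nodes,
whose integral is the value of the quadrature. -/
theorem exists_hermite {Q : ℕ} (hQ : 1 ≤ Q) (f f' : ℝ → ℝ) :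
    ∃ H : ℝ[X], H.degree < (2 * Q : ℕ) ∧
      (∀ ζ ∈ gaussNodes Q, H.eval ζ = f ζ ∧ (derivative H).eval ζ = f' ζ) ∧
      ∫ x in (-1 : ℝ)..1, H.eval x = ∑ ζ ∈ gaussNodes Q, gaussWeight Q ζ * f ζ := by
  classical
  have hinj : Set.InjOn (id : ℝ → ℝ) (gaussNodes Q) := Function.injective_id.injOn
  set p := Lagrange.interpolate (gaussNodes Q) id f with hp
  -- At a node the derivative of `node * q` is `node' * q`, so these values of `q` correct the
  -- derivative of `p` without changing its values. Orthogonality makes `node * q` invisible to the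
  -- integral.
  set q := Lagrange.interpolate (gaussNodes Q) id
    (fun ζ => (f' ζ - (derivative p).eval ζ) / (derivative (node Q)).eval ζ) with hq
  have hpd : p.degree < Q := by
    have := Lagrange.degree_interpolate_lt f hinj
    rwa [card_gaussNodes hQ] at this
  have hqd : q.degree < Q := by
    have := Lagrange.degree_interpolate_lt
      (fun ζ => (f' ζ - (derivative p).eval ζ) / (derivative (node Q)).eval ζ) hinj
    rwa [card_gaussNodes hQ] at this
  refine ⟨p + node Q * q, ?_, fun ζ hζ => ⟨?_, ?_⟩, ?_⟩
  · refine (degree_add_le _ _).trans_lt (max_lt (hpd.trans_le ?_) ?_)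
    · exact_mod_cast (by omega)
    · rw [degree_mul, degree_node hQ]
      by_cases h0 : q = 0
      · rw [h0, degree_zero, WithBot.add_bot]
        exact WithBot.bot_lt_coe _
      · rw [degree_eq_natDegree h0] at hqd ⊢
        have : q.natDegree < Q := by exact_mod_cast hqd
        exact_mod_cast (by omega)
  · have h1 : (node Q).eval ζ = 0 := Lagrange.eval_nodal_at_node (v := (id : ℝ → ℝ)) hζ
    have h2 : p.eval ζ = f ζ := Lagrange.eval_interpolate_at_node (v := (id : ℝ → ℝ)) f hinj hζ
    rw [eval_add, eval_mul, h1, h2, zero_mul, add_zero]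
  · have h1 : (node Q).eval ζ = 0 := Lagrange.eval_nodal_at_node (v := (id : ℝ → ℝ)) hζ
    have h2 : q.eval ζ = (f' ζ - (derivative p).eval ζ) / (derivative (node Q)).eval ζ :=
      Lagrange.eval_interpolate_at_node (v := (id : ℝ → ℝ))
        (fun ζ => (f' ζ - (derivative p).eval ζ) / (derivative (node Q)).eval ζ) hinj hζ
    have h3 : (derivative (node Q)).eval ζ ≠ 0 := by
      intro h0
      have := Lagrange.nodalWeight_eq_eval_derivative_nodal (v := (id : ℝ → ℝ)) hζ
      exact Lagrange.nodalWeight_ne_zero hinj hζ (by rw [this]; exact inv_eq_zero.2 h0)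
    rw [derivative_add, derivative_mul, eval_add, eval_add, eval_mul, eval_mul, h1, h2]
    field_simp
    ring
  · simp only [eval_add]
    rw [intervalIntegral.integral_add (eval_intervalIntegrable _ _ _)
      (eval_intervalIntegrable _ _ _), integral_node_mul_eq_zero hQ hqd,
      sum_gaussWeight_interpolate, add_zero]

/-- The constant `c` is chosen so that `F - H - c node²` also vanishes at `x`. Repeated Rolle yields
a zero of its derivative of order `2Q`, where `H` has disappeared and `node²` contributes `(2Q)!`.
-/
theorem hermite_error {Q : ℕ} (hQ : 1 ≤ Q) {F : ℕ → ℝ → ℝ}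
    (hF : ∀ j x, HasDerivAt (F j) (F (j + 1) x) x) {H : ℝ[X]} (hdeg : H.degree < (2 * Q : ℕ))
    (hH : ∀ ζ ∈ gaussNodes Q, H.eval ζ = F 0 ζ ∧ (derivative H).eval ζ = F 1 ζ)
    {M : ℝ} (hM : ∀ x ∈ Set.Icc (-1 : ℝ) 1, |F (2 * Q) x| ≤ M) {x : ℝ}
    (hx : x ∈ Set.Icc (-1 : ℝ) 1) :
    |F 0 x - H.eval x| ≤ M / (2 * Q).factorial * ((node Q).eval x) ^ 2 := by
  classical
  by_cases hxn : x ∈ gaussNodes Q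
  · rw [(hH x hxn).1, sub_self, abs_zero]
    have : 0 ≤ M := (abs_nonneg _).trans (hM x hx)
    positivity
  have hne : (node Q).eval x ≠ 0 := Lagrange.eval_nodal_not_at_node fun i hi h => hxn (h ▸ hi)
  set c := (F 0 x - H.eval x) / ((node Q).eval x) ^ 2 with hc
  set R := H + C c * node Q ^ 2 with hR
  let G : ℕ → ℝ → ℝ := fun j y => F j y - (derivative^[j] R).eval y
  have hG : ∀ j y, HasDerivAt (G j) (G (j + 1) y) y := fun j y => by
    have := (hF j y).sub ((derivative^[j] R).hasDerivAt y)
    rwa [← Function.iterate_succ_apply' derivative j R] at this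
  have hnode : ∀ ζ ∈ gaussNodes Q, (node Q).eval ζ = 0 := fun ζ hζ =>
    Lagrange.eval_nodal_at_node (v := (id : ℝ → ℝ)) hζ
  have hG0 : ∀ y ∈ insert x (gaussNodes Q), y ∈ Set.Icc (-1 : ℝ) 1 ∧ G 0 y = 0 := by
    intro y hy
    rcases Finset.mem_insert.1 hy with rfl | hy
    · refine ⟨hx, ?_⟩
      simp only [G, hR, hc, Function.iterate_zero_apply, eval_add, eval_mul, eval_C, eval_pow]
      field_simp
      ring
    · have := gaussNodes_subset hQ hy
      refine ⟨⟨this.1.le, this.2.le⟩, ?_⟩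
      simp [G, hR, hnode y hy, (hH y hy).1]
  -- The first derivative is counted by hand: `Q` Rolle zeros between the `Q + 1` zeros, plus the
  -- `Q` nodes, which are double zeros. Disjointness gives `2Q` zeros, enough for `2Q - 1` further
  -- derivatives.
  obtain ⟨t, htd, htc, ht⟩ := exists_finset_zeros_deriv (hG 0) _ hG0
  rw [Finset.card_insert_of_notMem hxn, card_gaussNodes hQ] at htc
  have htd' : Disjoint t (gaussNodes Q) :=
    htd.mono_right (Finset.subset_insert _ _)
  obtain ⟨ξ, hξ, hξ0⟩ := exists_zero_iterated_deriv (a := -1) (b := 1) (2 * Q - 1)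
    (fun j => G (j + 1)) (fun j => hG (j + 1)) (t ∪ gaussNodes Q)
    (by
      intro y hy
      rcases Finset.mem_union.1 hy with hy | hy
      · exact ht y hy
      · have := gaussNodes_subset hQ hy
        refine ⟨⟨this.1.le, this.2.le⟩, ?_⟩
        simp [G, hR, hnode y hy, (hH y hy).2, derivative_pow])
    (by rw [Finset.card_union_of_disjoint htd', card_gaussNodes hQ]; omega)
  simp only [G, show 2 * Q - 1 + 1 = 2 * Q by omega] at hξ0
  have hmonic : (node Q ^ 2).Monic := Lagrange.nodal_monic.pow 2
  have hnd : (node Q ^ 2).natDegree = 2 * Q := by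
    rw [Lagrange.nodal_monic.natDegree_pow, Lagrange.natDegree_nodal, card_gaussNodes hQ]
  have hder : derivative^[2 * Q] R = C (c * (2 * Q).factorial) := by
    rw [hR, iterate_map_add, iterate_derivative_eq_zero_of_degree_lt hdeg,
      iterate_derivative_C_mul, iterate_derivative_eq_C hnd.le]
    conv_lhs => rw [← hnd, coeff_natDegree, hmonic]
    simp [hnd]
  rw [hder, eval_C, sub_eq_zero] at hξ0
  have hcM : |c| ≤ M / (2 * Q).factorial := by
    rw [le_div_iff₀ (by positivity), ← abs_of_pos (show (0 : ℝ) < (2 * Q).factorial by positivity),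
      ← abs_mul, ← hξ0]
    exact hM ξ hξ
  have : F 0 x - H.eval x = c * ((node Q).eval x) ^ 2 := by
    rw [hc]; field_simp
  rw [this, abs_mul, abs_of_nonneg (sq_nonneg ((node Q).eval x))]
  gcongr

/-- The error of `Q`-point Gauss quadrature. -/
theorem gauss_error {Q : ℕ} (hQ : 1 ≤ Q) {F : ℕ → ℝ → ℝ}
    (hF : ∀ j x, HasDerivAt (F j) (F (j + 1) x) x)
    {M : ℝ} (hM : ∀ x ∈ Set.Icc (-1 : ℝ) 1, |F (2 * Q) x| ≤ M) :
    |∑ ζ ∈ gaussNodes Q, gaussWeight Q ζ * F 0 ζ - ∫ x in (-1 : ℝ)..1, F 0 x|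
      ≤ M / (2 * Q).factorial * (8 * Q / ((2 * Q + 1) * 4 ^ Q)) := by
  obtain ⟨H, hdeg, hH, hint⟩ := exists_hermite hQ (F 0) (F 1)
  have hM0 : 0 ≤ M := (abs_nonneg _).trans (hM 0 (by norm_num))
  have hcont : Continuous (F 0) :=
    continuous_iff_continuousAt.2 fun x => (hF 0 x).continuousAt
  rw [← hint, ← intervalIntegral.integral_sub (eval_intervalIntegrable _ _ _)
    (hcont.intervalIntegrable _ _)]
  calc |∫ x in (-1 : ℝ)..1, (H.eval x - F 0 x)|
      ≤ ∫ x in (-1 : ℝ)..1, |H.eval x - F 0 x| :=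
        intervalIntegral.abs_integral_le_integral_abs (by norm_num)
    _ ≤ ∫ x in (-1 : ℝ)..1, M / (2 * Q).factorial * ((node Q).eval x) ^ 2 := by
        refine intervalIntegral.integral_mono_on (by norm_num)
          ((H.continuous.sub hcont).abs.intervalIntegrable _ _)
          (Continuous.intervalIntegrable (by fun_prop) _ _) fun x hx => ?_
        rw [abs_sub_comm]
        exact hermite_error hQ hF hdeg hH hM hx
    _ = M / (2 * Q).factorial * ∫ x in (-1 : ℝ)..1, ((node Q).eval x) ^ 2 :=
        intervalIntegral.integral_const_mul _ _
    _ ≤ _ := by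
        gcongr
        exact integral_node_sq_le hQ

/-! ### Gauss quadrature of analytic vector-valued functions -/

section VectorValued

variable {E : Type*} [NormedAddCommGroup E] [InnerProductSpace ℂ E] [CompleteSpace E]

theorem hasDerivAt_re_inner_iteratedDeriv {f : ℂ → E} {U : Set ℂ} (hU : IsOpen U)
    (hf : DifferentiableOn ℂ f U) (hreal : ∀ x : ℝ, (x : ℂ) ∈ U) (e : E) (j : ℕ) (x : ℝ) :
    HasDerivAt (fun y : ℝ => (inner ℂ e (iteratedDeriv j f y)).re)
      ((inner ℂ e (iteratedDeriv (j + 1) f x)).re) x := by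
  have hA : AnalyticOnNhd ℂ f U := hf.analyticOnNhd hU
  have h1 : DifferentiableAt ℂ (iteratedDeriv j f) (x : ℂ) := by
    rw [iteratedDeriv_eq_iterate]
    exact (hA.iterated_deriv j _ (hreal x)).differentiableAt
  have h2 := h1.hasDerivAt
  rw [← iteratedDeriv_succ] at h2
  have h3 : HasDerivAt (fun z : ℂ => inner ℂ e (iteratedDeriv j f z))
      (inner ℂ e (iteratedDeriv (j + 1) f x)) (x : ℂ) := by
    exact ((innerSL ℂ e).hasFDerivAt).comp_hasDerivAt (x : ℂ) h2
  exact h3.real_of_complex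

/-- Rolle's theorem is scalar, so the scalar estimate is applied to `Re⟨e, f(x)⟩` with `e` the error
vector itself. This gives `‖e‖² ≤ ‖e‖ · bound`. -/
theorem gauss_error_vector {Q : ℕ} (hQ : 1 ≤ Q) {f : ℂ → E} {U : Set ℂ} (hU : IsOpen U)
    (hf : DifferentiableOn ℂ f U) (hreal : ∀ x : ℝ, (x : ℂ) ∈ U) {ρ B : ℝ} (hρ : 0 < ρ)
    (hball : ∀ x : ℝ, Metric.closedBall (x : ℂ) ρ ⊆ U)
    (hB : ∀ x : ℝ, ∀ z ∈ Metric.sphere (x : ℂ) ρ, ‖f z‖ ≤ B) :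
    ‖∑ ζ ∈ gaussNodes Q, gaussWeight Q ζ • f ζ - ∫ x in (-1 : ℝ)..1, f x‖
      ≤ B / ρ ^ (2 * Q) * (8 * Q / ((2 * Q + 1) * 4 ^ Q)) := by
  set e := ∑ ζ ∈ gaussNodes Q, gaussWeight Q ζ • f ζ - ∫ x in (-1 : ℝ)..1, f x with he
  have hcont : Continuous fun x : ℝ => f x := continuous_iff_continuousAt.2 fun x =>
    ((hf.differentiableAt (hU.mem_nhds (hreal x))).continuousAt).comp
      Complex.continuous_ofReal.continuousAt
  have hM : ∀ x ∈ Set.Icc (-1 : ℝ) 1, |(inner ℂ e (iteratedDeriv (2 * Q) f x)).re|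
      ≤ ‖e‖ * ((2 * Q).factorial * B / ρ ^ (2 * Q)) := by
    intro x _
    refine (Complex.abs_re_le_norm _).trans ((norm_inner_le_norm _ _).trans ?_)
    gcongr
    refine Complex.norm_iteratedDeriv_le_of_forall_mem_sphere_norm_le _ hρ ?_ (hB x)
    exact (hf.mono (by rw [closure_ball _ hρ.ne']; exact hball x)).diffContOnCl
  have key := gauss_error hQ (F := fun j y => (inner ℂ e (iteratedDeriv j f y)).re)
    (fun j x => hasDerivAt_re_inner_iteratedDeriv hU hf hreal e j x) hM
  simp only [iteratedDeriv_zero] at key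
  have hint : ∫ x in (-1 : ℝ)..1, (inner ℂ e (f x)).re
      = (inner ℂ e (∫ x in (-1 : ℝ)..1, f x)).re := by
    have := ((Complex.reCLM).comp ((innerSL ℂ e).restrictScalars ℝ)).intervalIntegral_comp_comm
      (hcont.intervalIntegrable (μ := MeasureTheory.volume) (-1) 1)
    simpa using this
  have hsum : ∑ ζ ∈ gaussNodes Q, gaussWeight Q ζ * (inner ℂ e (f ζ)).re
      = (inner ℂ e (∑ ζ ∈ gaussNodes Q, gaussWeight Q ζ • f ζ)).re := by
    rw [inner_sum, Complex.re_sum]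
    refine Finset.sum_congr rfl fun ζ _ => ?_
    rw [← Complex.coe_smul, inner_smul_right, Complex.re_ofReal_mul]
  rw [hint, hsum, ← Complex.sub_re, ← inner_sub_right, ← he] at key
  have hself : (inner ℂ e e).re = ‖e‖ ^ 2 := by
    rw [inner_self_eq_norm_sq_to_K]; norm_cast
  rw [hself, abs_of_nonneg (sq_nonneg _)] at key
  rcases (norm_nonneg e).eq_or_lt with h0 | h0
  · rw [← h0]
    have hB0 : 0 ≤ B := by
      have hmem : ((0 : ℝ) : ℂ) + ρ ∈ Metric.sphere ((0 : ℝ) : ℂ) ρ := by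
        simp [abs_of_pos hρ]
      exact (norm_nonneg _).trans (hB 0 _ hmem)
    positivity
  · refine le_of_mul_le_mul_left ?_ h0
    rw [← sq]
    refine key.trans (le_of_eq ?_)
    have : ((2 * Q).factorial : ℝ) ≠ 0 := by positivity
    field_simp

/-- Gauss quadrature on the panel `[m h, (m + 1) h]`. -/
theorem panel_error {Q : ℕ} (hQ : 1 ≤ Q) {f : ℂ → E} {U : Set ℂ} (hU : IsOpen U)
    (hf : DifferentiableOn ℂ f U) (hreal : ∀ x : ℝ, (x : ℂ) ∈ U) {h s B : ℝ} (hh : 0 < h)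
    (hs : 0 < s) (hball : ∀ x : ℝ, Metric.closedBall (x : ℂ) (h * s) ⊆ U)
    (hB : ∀ x : ℝ, ∀ z ∈ Metric.sphere (x : ℂ) (h * s), ‖f z‖ ≤ B) (m : ℤ) :
    ‖∑ ζ ∈ gaussNodes Q, (h / 2 * gaussWeight Q ζ) • f (point h (m, ζ) : ℝ)
        - ∫ x in (m * h)..((m + 1) * h), f (x : ℝ)‖
      ≤ h * (B / s ^ (2 * Q) * (4 * Q / ((2 * Q + 1) * 16 ^ Q))) := by
  set c : ℝ := (2 * (m : ℝ) + 1) * h / 2 with hc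
  let φ : ℂ → ℂ := fun z => (h / 2 : ℝ) * z + (c : ℝ)
  have hφ : Continuous φ := by fun_prop
  have hφd : Differentiable ℂ φ := by fun_prop
  have hφr : ∀ x : ℝ, φ x = ((h / 2 * x + c : ℝ) : ℂ) := fun x => by simp [φ]
  have hφdist : ∀ z (x : ℝ), dist (φ z) ((h / 2 * x + c : ℝ) : ℂ) = h / 2 * dist z x := by
    intro z x
    rw [← hφr, dist_eq_norm, dist_eq_norm, show φ z - φ x = ((h / 2 : ℝ) : ℂ) * (z - x) by
      simp only [φ]; ring, norm_mul, Complex.norm_real, Real.norm_of_nonneg (by positivity)]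
  -- The affine map has slope `h/2`, so radius `2s` in the reference variable is radius `hs` on the
  -- panel. The factor `(2s)^(2Q)` turns `4^Q` into `16^Q`.
  have key := gauss_error_vector hQ (f := f ∘ φ) (U := φ ⁻¹' U) (hU.preimage hφ)
    (hf.comp hφd.differentiableOn fun _ hz => hz)
    (fun x => by rw [Set.mem_preimage, hφr]; exact hreal _) (ρ := 2 * s) (B := B) (by positivity)
    (fun x z hz => hball (h / 2 * x + c) (by
      rw [Metric.mem_closedBall] at hz ⊢
      rw [hφdist]
      nlinarith))
    (fun x z hz => hB (h / 2 * x + c) _ (by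
      rw [Metric.mem_sphere] at hz ⊢
      rw [hφdist, hz]; ring))
  have hint : ∫ x in (m * h)..((m + 1) * h), f (x : ℝ)
      = (h / 2) • ∫ x in (-1 : ℝ)..1, (f ∘ φ) x := by
    have := intervalIntegral.smul_integral_comp_mul_add (a := -1) (b := 1)
      (fun x : ℝ => f x) (h / 2) c
    rw [show (m : ℝ) * h = h / 2 * (-1) + c by rw [hc]; ring,
      show ((m : ℝ) + 1) * h = h / 2 * 1 + c by rw [hc]; ring, ← this]
    simp only [Function.comp_apply, hφr]
  have hsum : ∑ ζ ∈ gaussNodes Q, (h / 2 * gaussWeight Q ζ) • f (point h (m, ζ) : ℝ)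
      = (h / 2) • ∑ ζ ∈ gaussNodes Q, gaussWeight Q ζ • (f ∘ φ) ζ := by
    rw [Finset.smul_sum]
    refine Finset.sum_congr rfl fun ζ _ => ?_
    rw [smul_smul, Function.comp_apply, hφr]
    rfl
  rw [hint, hsum, ← smul_sub, norm_smul, Real.norm_of_nonneg (by positivity)]
  refine (mul_le_mul_of_nonneg_left key (by positivity)).trans (le_of_eq ?_)
  rw [mul_pow, pow_mul 2 2 Q, show (16 : ℝ) ^ Q = (2 ^ 2) ^ Q * 4 ^ Q by
    rw [← mul_pow]; norm_num]
  field_simp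
  ring

/-- Composite Gauss quadrature on `[-n h, n h]`. -/
theorem composite_error {Q : ℕ} (hQ : 1 ≤ Q) {f : ℂ → E} {U : Set ℂ} (hU : IsOpen U)
    (hf : DifferentiableOn ℂ f U) (hreal : ∀ x : ℝ, (x : ℂ) ∈ U) {h s B : ℝ} (hh : 0 < h)
    (hs : 0 < s) (hball : ∀ x : ℝ, Metric.closedBall (x : ℂ) (h * s) ⊆ U)
    (hB : ∀ x : ℝ, ∀ z ∈ Metric.sphere (x : ℂ) (h * s), ‖f z‖ ≤ B) (n : ℕ) :
    ‖∑ j ∈ terms n Q, (h / 2 * gaussWeight Q j.2) • f (point h j : ℝ)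
        - ∫ x in (-(n * h))..(n * h), f (x : ℝ)‖
      ≤ n * h * (B / s ^ (2 * Q) * (8 * Q / ((2 * Q + 1) * 16 ^ Q))) := by
  have hcont : Continuous fun x : ℝ => f x := continuous_iff_continuousAt.2 fun x =>
    ((hf.differentiableAt (hU.mem_nhds (hreal x))).continuousAt).comp
      Complex.continuous_ofReal.continuousAt
  have hint : ∫ x in (-(n * h))..(n * h), f (x : ℝ)
      = ∑ m ∈ Finset.Ico (-(n : ℤ)) n, ∫ x in (m * h)..((m + 1) * h), f (x : ℝ) := by
    have h1 := intervalIntegral.sum_integral_adjacent_intervals (n := 2 * n)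
      (μ := MeasureTheory.volume) (f := fun x : ℝ => f x)
      (a := fun k : ℕ => ((k : ℝ) - n) * h)
      (fun k _ => hcont.intervalIntegrable _ _)
    rw [show (-(n * h) : ℝ) = (((0 : ℕ) : ℝ) - n) * h by push_cast; ring,
      show (n * h : ℝ) = (((2 * n : ℕ) : ℝ) - n) * h by push_cast; ring, ← h1]
    refine Finset.sum_bij (fun k _ => (k : ℤ) - n) ?_ ?_ ?_ ?_
    · intro k hk
      simp only [Finset.mem_range, Finset.mem_Ico] at hk ⊢
      omega
    · intro a _ b _ hab
      simpa using hab
    · intro m hm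
      simp only [Finset.mem_Ico] at hm
      exact ⟨(m + n).toNat, by simp only [Finset.mem_range]; omega, by omega⟩
    · intro k _
      push_cast
      rw [show (k : ℝ) + 1 - n = k - n + 1 by ring]
  rw [hint, terms, Finset.sum_product, ← Finset.sum_sub_distrib]
  refine (norm_sum_le_of_le _ fun m _ => panel_error hQ hU hf hreal hh hs hball hB m).trans ?_
  rw [Finset.sum_const, Int.card_Ico, nsmul_eq_mul, show ((n : ℤ) - -n).toNat = 2 * n by omega]
  push_cast
  apply le_of_eq
  ring

end VectorValued

/-! ### The branches of the Lambert function -/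

/-- Only the defining equation and the sign are used later, so existence of a preimage suffices and
uniqueness is never needed. -/
theorem lambertW0_spec {x : ℝ} (hx : 0 < x) :
    0 < lambertW0 x ∧ lambertW0 x * Real.exp (lambertW0 x) = x := by
  have hex : ∃ y ∈ Set.Ici (-1 : ℝ), y * Real.exp y = x := by
    have hc : ContinuousOn (fun y : ℝ => y * Real.exp y) (Set.Icc 0 x) := by fun_prop
    obtain ⟨y, hy, hyx⟩ := intermediate_value_Icc hx.le hc
      (show x ∈ Set.Icc (0 * Real.exp 0) (x * Real.exp x) by
        rw [zero_mul]
        exact ⟨hx.le, le_mul_of_one_le_right hx.le (Real.one_le_exp hx.le)⟩)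
    exact ⟨y, by simp only [Set.mem_Ici]; linarith [hy.1], hyx⟩
  have h : lambertW0 x * Real.exp (lambertW0 x) = x := Function.invFunOn_eq hex
  exact ⟨pos_of_mul_pos_left (h ▸ hx) (Real.exp_pos _).le, h⟩

theorem lambertWm1_spec {x : ℝ} (hx : -Real.exp (-1) ≤ x) (hx0 : x < 0) :
    lambertWm1 x ≤ -1 ∧ lambertWm1 x * Real.exp (lambertWm1 x) = x := by
  have hex : ∃ y ∈ Set.Iic (-1 : ℝ), y * Real.exp y = x := by
    have hlim : Filter.Tendsto (fun y : ℝ => y ^ 1 * Real.exp (-y)) Filter.atTop (nhds 0) :=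
      Real.tendsto_pow_mul_exp_neg_atTop_nhds_zero 1
    obtain ⟨w, hw1, hw2⟩ := ((hlim.eventually (gt_mem_nhds (show 0 < -x by linarith))).and
      (Filter.eventually_ge_atTop 1)).exists
    have hc : ContinuousOn (fun y : ℝ => y * Real.exp y) (Set.Icc (-w) (-1)) := by fun_prop
    obtain ⟨y, hy, hyx⟩ := intermediate_value_Icc' (by linarith) hc
      (show x ∈ Set.Icc (-1 * Real.exp (-1)) (-w * Real.exp (-w)) by
        rw [pow_one] at hw1
        exact ⟨by linarith, by linarith⟩)
    exact ⟨y, hy.2, hyx⟩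
  exact ⟨Function.invFunOn_mem hex, Function.invFunOn_eq hex⟩

theorem mul_exp_neg_le {a b : ℝ} (ha : 1 ≤ a) (hab : a ≤ b) :
    b * Real.exp (-b) ≤ a * Real.exp (-a) := by
  have h1 : b ≤ a * Real.exp (b - a) := by
    have := Real.add_one_le_exp (b - a)
    nlinarith
  calc b * Real.exp (-b) ≤ a * Real.exp (b - a) * Real.exp (-b) := by gcongr
    _ = a * Real.exp (-a) := by rw [mul_assoc, ← Real.exp_add]; ring_nf

/-! ### The parameters -/

theorem Cβ_pos (β : ℝ) : 0 < Cβ β := by unfold Cβ; positivity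

theorem cos_pos {β : ℝ} (h0 : 0 < β) (h1 : β < 1) : 0 < Real.cos (β * Real.pi / 2) :=
  Real.cos_pos_of_mem_Ioo ⟨by nlinarith [Real.pi_pos], by nlinarith [Real.pi_pos]⟩

theorem Bβ_pos {β : ℝ} (h0 : 0 < β) (h1 : β < 1) : 0 < Bβ β := by
  have := cos_pos h0 h1
  have := Cβ_pos β
  unfold Bβ; positivity

/-- `K^β = (2β/c) W₀(x)`; raising `W₀ e^{W₀} = x` to the power `β` gives this equation, the only
form in which `K` is used. -/
theorem truncLevel_spec {β ε : ℝ} (h0 : 0 < β) (h1 : β < 1) (hε : 0 < ε) :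
    0 < truncLevel β ε ∧ (truncLevel β ε ^ β) ^ β
      * Real.exp (Real.cos (β * Real.pi / 2) * truncLevel β ε ^ β / 2) = Bβ β / ε := by
  have hc := cos_pos h0 h1
  have hB := Bβ_pos h0 h1
  set c := Real.cos (β * Real.pi / 2)
  set x := (Bβ β / ε) ^ (1 / β) * (c / (2 * β)) with hx
  obtain ⟨hy, hyx⟩ := lambertW0_spec (x := x) (by positivity)
  set y := lambertW0 x
  have hK : truncLevel β ε = (2 * β / c * y) ^ (1 / β) := rfl
  have hKβ : truncLevel β ε ^ β = 2 * β / c * y := by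
    rw [hK, ← Real.rpow_mul (by positivity), one_div_mul_cancel h0.ne', Real.rpow_one]
  refine ⟨by rw [hK]; positivity, ?_⟩
  rw [hKβ, show c * (2 * β / c * y) / 2 = y * β by field_simp, Real.exp_mul,
    ← Real.mul_rpow (by positivity) (by positivity), mul_assoc, hyx, hx,
    show 2 * β / c * ((Bβ β / ε) ^ (1 / β) * (c / (2 * β))) = (Bβ β / ε) ^ (1 / β) by
      field_simp, ← Real.rpow_mul (by positivity), one_div_mul_cancel h0.ne', Real.rpow_one]

theorem log2e_eq : log2e = 1 / Real.log 2 := by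
  rw [log2e, Real.logb, Real.log_exp]

/-- With `w = W₋₁(quadArg)`, the ceiling gives `4 Q log 2 ≥ -w ≥ 1`. Since `y e^{-y}` decreases on
`[1, ∞)`, `4 Q log 2 / 16^Q` is at most `-quadArg`, which is the claim rescaled. -/
theorem quadPoints_spec {β K ε : ℝ} (hK : 0 < K) (hε : 0 < ε)
    (hdom : -Real.exp (-1) ≤ quadArg β K ε) :
    1 ≤ quadPoints β K ε ∧
      K * (8 * Real.pi * Real.exp (1 / 3) * quadPoints β K ε / (3 * Cβ β * 16 ^ quadPoints β K ε))
        ≤ ε := by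
  have hC := Cβ_pos β
  have hl : 0 < Real.log 2 := Real.log_pos (by norm_num)
  have hq : quadArg β K ε = -(3 * Cβ β * Real.log 2 * ε / (2 * Real.pi * Real.exp (1 / 3) * K)) := by
    rw [quadArg, log2e_eq]
    field_simp
  obtain ⟨hw, hwx⟩ := lambertWm1_spec hdom (by rw [hq, neg_lt_zero]; positivity)
  rw [hq] at hwx
  set Q := quadPoints β K ε with hQdef
  have hQ : 1 / (4 * Real.log 2) * (-lambertWm1 (quadArg β K ε)) ≤ Q := by
    refine le_trans (le_of_eq ?_) (Nat.le_ceil _)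
    rw [log2e_eq]
    field_simp
  rw [hq] at hQ hw
  set w := lambertWm1 (-(3 * Cβ β * Real.log 2 * ε / (2 * Real.pi * Real.exp (1 / 3) * K)))
  have hQ1 : -w ≤ 4 * Real.log 2 * Q := by
    rw [one_div_mul_eq_div, div_le_iff₀ (by positivity)] at hQ
    linarith
  have hQpos : 0 < (Q : ℝ) := by
    have : 0 < 4 * Real.log 2 * Q := by linarith
    exact pos_of_mul_pos_right this (by positivity)
  refine ⟨by exact_mod_cast hQpos, ?_⟩
  have h1 := mul_exp_neg_le (by linarith) hQ1
  rw [neg_neg, neg_mul, hwx, neg_neg] at h1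
  have h2 : Real.exp (-(4 * Real.log 2 * Q)) = 1 / 16 ^ Q := by
    rw [Real.exp_neg, one_div, mul_comm, Real.exp_nat_mul, mul_comm (4 : ℝ), Real.exp_mul,
      Real.exp_log (by norm_num)]
    norm_num
  rw [h2, mul_one_div, div_le_div_iff₀ (by positivity) (by positivity)] at h1
  rw [mul_div_assoc', div_le_iff₀ (by positivity)]
  have h3 : Real.log 2 * (K * (8 * Real.pi * Real.exp (1 / 3) * Q))
      ≤ Real.log 2 * (ε * (3 * Cβ β * 16 ^ Q)) := by nlinarith
  exact le_of_mul_le_mul_left h3 hl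

/-! ### Numerical lower bound for the truncation level -/

theorem Cβ_le {β : ℝ} (h0 : 0 < β) : Cβ β ≤ 2.312 := by
  have h1 : (1 : ℝ) ≤ 2 ^ β := Real.one_le_rpow (by norm_num) h0.le
  have h2 : Real.exp (-(2 : ℝ) ^ β) ≤ Real.exp (-1) := Real.exp_le_exp.2 (by linarith)
  have h3 := Real.pi_lt_d4
  have h4 := Real.exp_one_gt_d9
  have h5 : Real.exp (-1) ≤ 1 / 2.718 := by
    rw [Real.exp_neg, ← one_div]
    exact one_div_le_one_div_of_le (by norm_num) (by linarith)
  unfold Cβ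
  calc 2 * Real.pi * Real.exp (-(2 : ℝ) ^ β) ≤ 2 * 3.1416 * (1 / 2.718) := by
        gcongr
        exact h2.trans h5
    _ ≤ 2.312 := by norm_num

theorem cos_eq_sin_one_sub (β : ℝ) :
    Real.cos (β * Real.pi / 2) = Real.sin ((1 - β) * Real.pi / 2) := by
  rw [← Real.sin_pi_div_two_sub]
  ring_nf

/-- For `1/2 ≤ β < 1`, `⌈1/β⌉ = 2` and `B_β = 16/(C_β c²)`, so this says that the equation for `K`
evaluated at `9` stays below `B_β`. The factor `c²` must be kept, since `B_β` grows as `β → 1`. The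
three factors give about `15.7`. -/
theorem bound_of_half_le {β : ℝ} (h0 : 1 / 2 ≤ β) (h1 : β < 1) :
    Cβ β * Real.cos (β * Real.pi / 2) ^ 2 * (((9 : ℝ) ^ β) ^ β
      * Real.exp (Real.cos (β * Real.pi / 2) * (9 : ℝ) ^ β / 2)) < 16 := by
  have hC := Cβ_le (β := β) (by linarith)
  have hC0 := Cβ_pos β
  have hc := cos_pos (β := β) (by linarith) h1
  have hpi := Real.pi_pos
  have hpi' := Real.pi_lt_d4
  have hcδ : Real.cos (β * Real.pi / 2) ≤ (1 - β) * Real.pi / 2 := by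
    rw [cos_eq_sin_one_sub]
    exact Real.sin_le (by nlinarith)
  have hc2 : Real.cos (β * Real.pi / 2) ^ 2 ≤ 1 / 2 := by
    have h2 : Real.cos (β * Real.pi / 2) ≤ Real.cos (Real.pi / 4) :=
      Real.cos_le_cos_of_nonneg_of_le_pi (by positivity) (by nlinarith) (by nlinarith)
    rw [Real.cos_pi_div_four] at h2
    calc Real.cos (β * Real.pi / 2) ^ 2 ≤ (√2 / 2) ^ 2 := by gcongr
      _ = 1 / 2 := by rw [div_pow, Real.sq_sqrt (by norm_num)]; norm_num
  set c := Real.cos (β * Real.pi / 2)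
  -- From `e² ≤ 9`. With `δ = 2(1 - β)` the exponent below is then at most `(9π/8) δe^{-δ}`, and
  -- `δe^{-δ} ≤ 1/e`.
  have h9 : (9 : ℝ) ^ β ≤ 9 * Real.exp (-(2 * (1 - β))) := by
    rw [show β = 1 + -(1 - β) by ring, Real.rpow_add (by norm_num), Real.rpow_one,
      show -(2 * (1 - (1 + -(1 - β)))) = 2 * (-(1 - β)) by ring, Real.exp_mul]
    gcongr 9 * ?_
    refine Real.rpow_le_rpow_of_nonpos (Real.exp_pos _) ?_ (by linarith)
    rw [show (2 : ℝ) = ((2 : ℕ) : ℝ) * 1 by norm_num, Real.exp_nat_mul]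
    have := Real.exp_one_lt_d9
    have := Real.exp_pos 1
    nlinarith
  have hexp : Real.exp (c * (9 : ℝ) ^ β / 2) ≤ 3.94 := by
    have h3 : (2 * (1 - β)) * Real.exp (-(2 * (1 - β))) ≤ Real.exp (-1) := by
      have := Real.add_one_le_exp (2 * (1 - β) - 1)
      calc (2 * (1 - β)) * Real.exp (-(2 * (1 - β)))
          ≤ Real.exp (2 * (1 - β) - 1) * Real.exp (-(2 * (1 - β))) := by gcongr; linarith
        _ = Real.exp (-1) := by rw [← Real.exp_add]; ring_nf
    have h5 : Real.exp (-1) ≤ 1 / 2.718 := by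
      rw [Real.exp_neg, ← one_div]
      exact one_div_le_one_div_of_le (by norm_num) (by linarith [Real.exp_one_gt_d9])
    have h4 : c * (9 : ℝ) ^ β / 2 ≤ 1.31 := by
      calc c * (9 : ℝ) ^ β / 2
          ≤ ((1 - β) * Real.pi / 2) * (9 * Real.exp (-(2 * (1 - β)))) / 2 := by
            gcongr
        _ = 9 * Real.pi / 8 * ((2 * (1 - β)) * Real.exp (-(2 * (1 - β)))) := by ring
        _ ≤ 9 * 3.1416 / 8 * (1 / 2.718) := by
            gcongr
            exact h3.trans h5
        _ ≤ 1.31 := by norm_num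
    have h6 : Real.exp 0.31 ≤ 1 / 0.69 := by
      have := Real.add_one_le_exp (-0.31 : ℝ)
      rw [show (0.31 : ℝ) = -(-0.31) by norm_num, Real.exp_neg, ← one_div]
      exact one_div_le_one_div_of_le (by norm_num) (by linarith)
    calc Real.exp (c * (9 : ℝ) ^ β / 2) ≤ Real.exp (1 + 0.31) :=
          Real.exp_le_exp.2 (by linarith)
      _ = Real.exp 1 * Real.exp 0.31 := Real.exp_add _ _
      _ ≤ 2.7183 * (1 / 0.69) := by
          gcongr
          linarith [Real.exp_one_lt_d9]
      _ ≤ 3.94 := by norm_num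
  have h99 : ((9 : ℝ) ^ β) ^ β = (9 : ℝ) ^ (β * β) := (Real.rpow_mul (by norm_num) _ _).symm
  have hmain : c ^ 2 * ((9 : ℝ) ^ β) ^ β ≤ 1.725 := by
    -- Up to `3/4`, `c² ≤ 1/2` and `9^(9/16) ≤ 3.45` suffice; beyond it, `c ≤ π/8 < 0.4` compensates
    -- for the crude `9^(β²) ≤ 9`.
    rcases le_or_gt β (3 / 4) with hβ | hβ
    · have h8 : (9 : ℝ) ^ (β * β) ≤ 3.45 := by
        have h10 : (9 : ℝ) ^ (β * β) ≤ (9 : ℝ) ^ ((9 : ℝ) / 16) :=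
          Real.rpow_le_rpow_of_exponent_le (by norm_num) (by nlinarith)
        refine h10.trans ?_
        rw [show (9 : ℝ) / 16 = 9 * (16 : ℝ)⁻¹ by norm_num, Real.rpow_mul (by norm_num),
          Real.rpow_inv_le_iff_of_pos (by positivity) (by norm_num) (by norm_num)]
        norm_num
      rw [h99]
      calc c ^ 2 * (9 : ℝ) ^ (β * β) ≤ 1 / 2 * 3.45 := by gcongr
        _ = 1.725 := by norm_num
    · have h8 : (9 : ℝ) ^ (β * β) ≤ 9 := by
        conv_rhs => rw [← Real.rpow_one 9]
        exact Real.rpow_le_rpow_of_exponent_le (by norm_num) (by nlinarith)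
      have hc' : c ≤ 0.4 := by nlinarith
      rw [h99]
      calc c ^ 2 * (9 : ℝ) ^ (β * β) ≤ 0.4 ^ 2 * 9 := by gcongr
        _ ≤ 1.725 := by norm_num
  calc Cβ β * c ^ 2 * (((9 : ℝ) ^ β) ^ β * Real.exp (c * (9 : ℝ) ^ β / 2))
      = Cβ β * (c ^ 2 * ((9 : ℝ) ^ β) ^ β) * Real.exp (c * (9 : ℝ) ^ β / 2) := by ring
    _ ≤ 2.312 * 1.725 * 3.94 := by gcongr
    _ < 16 := by norm_num

theorem bound_of_lt_half {β : ℝ} (h0 : 0 < β) (h1 : β < 1 / 2) :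
    Cβ β * (((9 : ℝ) ^ β) ^ β
      * Real.exp (Real.cos (β * Real.pi / 2) * (9 : ℝ) ^ β / 2)) < 96 := by
  have hC := Cβ_le h0
  have hC0 := Cβ_pos β
  have h9 : (9 : ℝ) ^ β ≤ 3 := by
    refine (Real.rpow_le_rpow_of_exponent_le (by norm_num) h1.le).trans ?_
    rw [← Real.sqrt_eq_rpow, Real.sqrt_le_left (by norm_num)]
    norm_num
  have h99 : ((9 : ℝ) ^ β) ^ β ≤ 3 := by
    calc ((9 : ℝ) ^ β) ^ β ≤ 3 ^ β := by gcongr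
      _ ≤ 3 ^ (1 : ℝ) := Real.rpow_le_rpow_of_exponent_le (by norm_num) (by linarith)
      _ = 3 := Real.rpow_one _
  have hexp : Real.exp (Real.cos (β * Real.pi / 2) * (9 : ℝ) ^ β / 2) ≤ 9 := by
    have h2 : Real.cos (β * Real.pi / 2) * (9 : ℝ) ^ β / 2 ≤ 2 := by
      have := Real.cos_le_one (β * Real.pi / 2)
      have : 0 < (9 : ℝ) ^ β := by positivity
      nlinarith
    calc _ ≤ Real.exp (((2 : ℕ) : ℝ) * 1) := Real.exp_le_exp.2 (by norm_num; exact h2)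
      _ = Real.exp 1 ^ 2 := Real.exp_nat_mul _ _
      _ ≤ 3 ^ 2 := by gcongr; linarith [Real.exp_one_lt_d9]
      _ = 9 := by norm_num
  calc _ ≤ (2.312 * (3 * 9) : ℝ) := by gcongr
    _ < 96 := by norm_num

/-- The left side of the equation for `K` increases with `K`, and its right side is at least `B_β`
when `ε ≤ 1`. So `K < 9` would contradict the numerical bounds at `9`. For `β < 1/2` the exponent
`⌈1/β⌉` is at least `3`, whence the constant `2⁴ · 3! = 96`. -/
theorem nine_le_truncLevel {β ε : ℝ} (h0 : 0 < β) (h1 : β < 1) (hε : 0 < ε) (hε1 : ε ≤ 1) :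
    9 ≤ truncLevel β ε := by
  obtain ⟨hK, hKeq⟩ := truncLevel_spec h0 h1 hε
  have hc := cos_pos h0 h1
  have hC := Cβ_pos β
  by_contra! hlt
  have hB : Bβ β ≤ ((9 : ℝ) ^ β) ^ β
      * Real.exp (Real.cos (β * Real.pi / 2) * (9 : ℝ) ^ β / 2) := by
    calc Bβ β ≤ Bβ β / ε := by
          rw [le_div_iff₀ hε]
          nlinarith [Bβ_pos h0 h1]
      _ = _ := hKeq.symm
      _ ≤ _ := by gcongr
  rw [Bβ, div_le_iff₀ (by positivity)] at hB
  rcases le_or_gt (1 / 2) β with hβ | hβ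
  · have hn : ⌈1 / β⌉₊ = 2 := by
      rw [Nat.ceil_eq_iff (by norm_num)]
      constructor
      · rw [lt_div_iff₀ h0]; norm_num; linarith
      · rw [div_le_iff₀ h0]; push_cast; linarith
    have h2 := bound_of_half_le hβ h1
    rw [hn] at hB
    norm_num [Nat.factorial] at hB
    linarith
  · have hn : 3 ≤ ⌈1 / β⌉₊ := by
      rw [Nat.add_one_le_ceil_iff, lt_div_iff₀ h0]
      push_cast
      linarith
    have h2 := bound_of_lt_half h0 hβ
    have h3 : (96 : ℝ) ≤ 2 ^ (⌈1 / β⌉₊ + 1) * (Nat.factorial ⌈1 / β⌉₊ : ℝ) := by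
      calc (96 : ℝ) = 2 ^ (3 + 1) * (Nat.factorial 3 : ℝ) := by norm_num [Nat.factorial]
        _ ≤ _ := by gcongr; norm_num
    have h4 : Real.cos (β * Real.pi / 2) ^ ⌈1 / β⌉₊ ≤ 1 :=
      pow_le_one₀ hc.le (Real.cos_le_one _)
    have h5 : ((9 : ℝ) ^ β) ^ β * Real.exp (Real.cos (β * Real.pi / 2) * (9 : ℝ) ^ β / 2)
        * (Cβ β * Real.cos (β * Real.pi / 2) ^ ⌈1 / β⌉₊)
        ≤ ((9 : ℝ) ^ β) ^ β * Real.exp (Real.cos (β * Real.pi / 2) * (9 : ℝ) ^ β / 2)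
        * (Cβ β * 1) := by gcongr
    linarith

/-! ### Bounds for the kernel -/

/-- Both sides are compared with `1 + β(cos θ - 1)`: Bernoulli from below, concavity of the cosine
from above. -/
theorem cos_rpow_le_cos_mul {β θ : ℝ} (h0 : 0 < β) (h1 : β < 1) (hθ : |θ| < Real.pi / 2) :
    Real.cos θ ^ β ≤ Real.cos (θ * β) := by
  obtain ⟨hθ1, hθ2⟩ := abs_lt.1 hθ
  have hcos : 0 < Real.cos θ := Real.cos_pos_of_mem_Ioo ⟨hθ1, hθ2⟩
  have hconc := strictConcaveOn_cos_Icc.concaveOn.2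
    (show θ ∈ Set.Icc (-(Real.pi / 2)) (Real.pi / 2) from ⟨hθ1.le, hθ2.le⟩)
    (show (0 : ℝ) ∈ Set.Icc (-(Real.pi / 2)) (Real.pi / 2) from
      ⟨by linarith [Real.pi_pos], by linarith [Real.pi_pos]⟩)
    h0.le (sub_nonneg.2 h1.le) (by ring)
  simp only [smul_eq_mul, mul_zero, add_zero, Real.cos_zero, mul_one] at hconc
  have hb := rpow_one_add_le_one_add_mul_self (s := Real.cos θ - 1) (by linarith) h0.le h1.le
  rw [show 1 + (Real.cos θ - 1) = Real.cos θ by ring] at hb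
  rw [mul_comm θ]
  linarith

theorem rpow_re_le_re_cpow {β : ℝ} (h0 : 0 < β) (h1 : β < 1) {s : ℂ} (hs : 0 < s.re) :
    s.re ^ β ≤ (s ^ (β : ℂ)).re := by
  have hs0 : s ≠ 0 := fun h => by simp [h] at hs
  have harg : |Complex.arg s| < Real.pi / 2 :=
    Complex.abs_arg_lt_pi_div_two_iff.2 (Or.inl hs)
  have hcos : 0 ≤ Real.cos (Complex.arg s) :=
    (Real.cos_pos_of_mem_Ioo (abs_lt.1 harg)).le
  rw [Complex.cpow_ofReal_re, ← Complex.norm_mul_cos_arg s, Real.mul_rpow (norm_nonneg _) hcos]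
  gcongr
  exact cos_rpow_le_cos_mul h0 h1 harg

theorem cos_mul_rpow_norm_le_re_cpow {β : ℝ} (h0 : 0 < β) (h1 : β < 1) {s : ℂ} (hs : 0 < s.re) :
    Real.cos (β * Real.pi / 2) * ‖s‖ ^ β ≤ (s ^ (β : ℂ)).re := by
  have harg : |Complex.arg s| < Real.pi / 2 :=
    Complex.abs_arg_lt_pi_div_two_iff.2 (Or.inl hs)
  rw [Complex.cpow_ofReal_re, mul_comm, ← Real.cos_abs (Complex.arg s * β), abs_mul,
    abs_of_pos h0]
  gcongr
  exact Real.cos_le_cos_of_nonneg_of_le_pi (by positivity) (by nlinarith [Real.pi_pos])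
    (by nlinarith)

/-- The numerator `exp(-(1 + i z)^β) / C_β` of the kernel, as an analytic function. -/
def kernelNum (β : ℝ) (z : ℂ) : ℂ :=
  Complex.exp (-(1 + Complex.I * z) ^ (β : ℂ)) / (Cβ β : ℂ)

/-- The analytic continuation of the kernel. -/
def kernelC (β : ℝ) (z : ℂ) : ℂ := (1 - Complex.I * z)⁻¹ * kernelNum β z

theorem kernelC_ofReal (β k : ℝ) : kernelC β k = kernel β k := by
  rw [kernelC, kernelNum, kernel, Complex.exp_neg]
  have := Complex.exp_ne_zero ((1 + Complex.I * (k : ℂ)) ^ (β : ℂ))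
  field_simp

theorem re_one_add_I_mul (z : ℂ) : (1 + Complex.I * z).re = 1 - z.im := by simp [sub_eq_add_neg]

theorem re_one_sub_I_mul (z : ℂ) : (1 - Complex.I * z).re = 1 + z.im := by simp

theorem differentiableAt_kernelNum {β : ℝ} {z : ℂ} (hz : z.im < 1) :
    DifferentiableAt ℂ (kernelNum β) z := by
  have h1 : DifferentiableAt ℂ (fun z : ℂ => 1 + Complex.I * z) z := by fun_prop
  have h2 : (1 + Complex.I * z) ∈ Complex.slitPlane :=
    Or.inl (by rw [re_one_add_I_mul]; linarith)
  exact ((h1.cpow_const h2).neg.cexp).div_const _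

theorem differentiableAt_kernelC {β : ℝ} {z : ℂ} (hz : |z.im| < 1) :
    DifferentiableAt ℂ (kernelC β) z := by
  obtain ⟨hz1, hz2⟩ := abs_lt.1 hz
  have h1 : DifferentiableAt ℂ (fun z : ℂ => 1 - Complex.I * z) z := by fun_prop
  refine (h1.inv fun h => ?_).mul (differentiableAt_kernelNum hz2)
  have := re_one_sub_I_mul z
  rw [h, Complex.zero_re] at this
  linarith

theorem norm_kernelNum (β : ℝ) (z : ℂ) :
    ‖kernelNum β z‖ = Real.exp (-((1 + Complex.I * z) ^ (β : ℂ)).re) / Cβ β := by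
  rw [kernelNum, norm_div, Complex.norm_exp, Complex.neg_re, Complex.norm_real,
    Real.norm_of_nonneg (Cβ_pos β).le]

/-- With `y = Im z`, `|1 - iz| ≥ 1 + y` and `Re (1 + iz)^β ≥ (1 - y)^β`. For `y ≤ 0` the exponential
is at most `e^{-1}` and only the denominator loses. For `y > 0` the exponential loses at most `e^y`,
and `(1 - y)e^y ≤ 1`. -/
theorem norm_kernelC_le {β : ℝ} (h0 : 0 < β) (h1 : β < 1) {r : ℝ} (hr : r < 1) {z : ℂ}
    (hz : |z.im| ≤ r) : ‖kernelC β z‖ ≤ Real.exp (-1) / (Cβ β * (1 - r)) := by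
  obtain ⟨hz1, hz2⟩ := abs_le.1 hz
  have hC := Cβ_pos β
  have hre := rpow_re_le_re_cpow h0 h1 (s := 1 + Complex.I * z)
    (by rw [re_one_add_I_mul]; linarith)
  rw [re_one_add_I_mul] at hre
  have hden : 1 + z.im ≤ ‖1 - Complex.I * z‖ := by
    rw [← re_one_sub_I_mul]; exact Complex.re_le_norm _
  have hden0 : 0 < 1 + z.im := by linarith
  rw [kernelC, norm_mul, norm_inv, norm_kernelNum]
  have hexp : Real.exp (-((1 + Complex.I * z) ^ (β : ℂ)).re) ≤ Real.exp (-((1 - z.im) ^ β)) :=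
    Real.exp_le_exp.2 (by linarith)
  have hmain : (1 - r) * Real.exp (-((1 - z.im) ^ β)) ≤ (1 + z.im) * Real.exp (-1) := by
    rcases le_or_gt z.im 0 with hi | hi
    · have : (1 : ℝ) ≤ (1 - z.im) ^ β := Real.one_le_rpow (by linarith) h0.le
      have h3 : Real.exp (-((1 - z.im) ^ β)) ≤ Real.exp (-1) := Real.exp_le_exp.2 (by linarith)
      have : 0 ≤ 1 - r := by linarith
      gcongr
      linarith
    · have h2 : 1 - z.im ≤ (1 - z.im) ^ β := by
        conv_lhs => rw [← Real.rpow_one (1 - z.im)]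
        exact Real.rpow_le_rpow_of_exponent_ge (by linarith) (by linarith) h1.le
      have h3 : Real.exp (-((1 - z.im) ^ β)) ≤ Real.exp (z.im) * Real.exp (-1) := by
        rw [← Real.exp_add]
        exact Real.exp_le_exp.2 (by linarith)
      have h4 : (1 - z.im) * Real.exp z.im ≤ 1 := by
        have := Real.add_one_le_exp (-z.im)
        calc (1 - z.im) * Real.exp z.im ≤ Real.exp (-z.im) * Real.exp z.im := by
              gcongr; linarith
          _ = 1 := by rw [← Real.exp_add]; simp
      calc (1 - r) * Real.exp (-((1 - z.im) ^ β))
          ≤ (1 - z.im) * (Real.exp (z.im) * Real.exp (-1)) := by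
            gcongr
            · linarith
        _ = ((1 - z.im) * Real.exp z.im) * Real.exp (-1) := by ring
        _ ≤ (1 + z.im) * Real.exp (-1) := by gcongr; linarith
  calc ‖1 - Complex.I * z‖⁻¹ * (Real.exp (-((1 + Complex.I * z) ^ (β : ℂ)).re) / Cβ β)
      ≤ (1 + z.im)⁻¹ * (Real.exp (-((1 - z.im) ^ β)) / Cβ β) := by gcongr
    _ ≤ Real.exp (-1) / (Cβ β * (1 - r)) := by
        rw [inv_mul_eq_div, div_div, div_le_div_iff₀ (by positivity)
          (mul_pos hC (by linarith))]
        nlinarith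

theorem norm_le_norm_one_add_I_mul {z : ℂ} (hz : z.im ≤ 0) : ‖z‖ ≤ ‖1 + Complex.I * z‖ := by
  rw [← sq_le_sq₀ (norm_nonneg _) (norm_nonneg _), Complex.sq_norm, Complex.sq_norm,
    Complex.normSq_apply, Complex.normSq_apply]
  simp
  nlinarith

theorem norm_kernelNum_le {β : ℝ} (h0 : 0 < β) (h1 : β < 1) {z : ℂ} (hz : z.im ≤ 0) {R : ℝ}
    (hR0 : 0 ≤ R) (hR : R ≤ ‖z‖) :
    ‖kernelNum β z‖ ≤ Real.exp (-(Real.cos (β * Real.pi / 2) * R ^ β)) / Cβ β := by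
  have hC := Cβ_pos β
  have hc := cos_pos h0 h1
  rw [norm_kernelNum]
  gcongr
  refine le_trans ?_ (cos_mul_rpow_norm_le_re_cpow h0 h1
    (by rw [re_one_add_I_mul]; linarith))
  gcongr
  exact hR.trans (norm_le_norm_one_add_I_mul hz)

theorem norm_kernel_le {β : ℝ} (h0 : 0 < β) (h1 : β < 1) {k a : ℝ} (ha : 0 < a)
    (hak : a ≤ ‖1 - Complex.I * k‖) :
    ‖kernel β k‖ ≤ Real.exp (-(Real.cos (β * Real.pi / 2) * |k| ^ β)) / (Cβ β * a) := by
  have hC := Cβ_pos β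
  have h := norm_kernelNum_le h0 h1 (z := k) (by simp) (abs_nonneg k) (by simp)
  rw [← kernelC_ofReal, kernelC, norm_mul, norm_inv]
  calc ‖1 - Complex.I * k‖⁻¹ * ‖kernelNum β k‖
      ≤ a⁻¹ * (Real.exp (-(Real.cos (β * Real.pi / 2) * |k| ^ β)) / Cβ β) := by gcongr
    _ = _ := by field_simp

theorem norm_kernel_neg (β k : ℝ) : ‖kernel β (-k)‖ = ‖kernel β k‖ := by
  have h1 : 1 + Complex.I * ((-k : ℝ) : ℂ) = (starRingEnd ℂ) (1 + Complex.I * k) := by simp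
  have h2 : 1 - Complex.I * ((-k : ℝ) : ℂ) = (starRingEnd ℂ) (1 - Complex.I * k) := by simp
  have harg : Complex.arg (1 + Complex.I * k) ≠ Real.pi := by
    have : |Complex.arg (1 + Complex.I * k)| < Real.pi / 2 :=
      Complex.abs_arg_lt_pi_div_two_iff.2 (Or.inl (by simp))
    have := (abs_lt.1 this).2
    linarith [Real.pi_pos]
  have h3 := Complex.conj_cpow (1 + Complex.I * k) (β : ℂ) harg
  rw [Complex.conj_ofReal] at h3
  rw [← kernelC_ofReal, ← kernelC_ofReal, kernelC, kernelC, norm_mul, norm_mul, norm_inv, norm_inv,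
    norm_kernelNum, norm_kernelNum, h1, h2, h3, Complex.conj_re, Complex.norm_conj]

theorem norm_kernel_le_one_div {β : ℝ} (h0 : 0 < β) (h1 : β < 1) (k : ℝ) :
    ‖kernel β k‖ ≤ 1 / Cβ β := by
  have hC := Cβ_pos β
  have hc := cos_pos h0 h1
  refine (norm_kernel_le h0 h1 one_pos ?_).trans ?_
  · have := Complex.re_le_norm (1 - Complex.I * (k : ℂ))
    rwa [re_one_sub_I_mul, Complex.ofReal_im, add_zero] at this
  · rw [mul_one]
    gcongr
    rw [Real.exp_le_one_iff, neg_nonpos]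
    positivity

theorem norm_kernel_le_of_pos {β : ℝ} (h0 : 0 < β) (h1 : β < 1) {k : ℝ} (hk : 0 < |k|) :
    ‖kernel β k‖ ≤ Real.exp (-(Real.cos (β * Real.pi / 2) * |k| ^ β)) / (Cβ β * |k|) := by
  refine norm_kernel_le h0 h1 hk ?_
  have := Complex.abs_im_le_norm (1 - Complex.I * (k : ℂ))
  simpa using this

/-- One term of the exponential series, of index `n = ⌈1/β⌉`, the least for which `(k^β)^n ≥ k` for
every `k ≥ 1`. -/
theorem exp_neg_mul_rpow_le {β a k : ℝ} (h0 : 0 < β) (ha : 0 < a) (hk : 1 ≤ k) :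
    Real.exp (-(a * k ^ β)) ≤ (Nat.factorial ⌈1 / β⌉₊ : ℝ) / a ^ ⌈1 / β⌉₊ / k := by
  set n := ⌈1 / β⌉₊
  have hn : 1 ≤ β * n := by
    have := Nat.le_ceil (1 / β)
    rwa [div_le_iff₀' h0] at this
  have h1 := Real.pow_div_factorial_le_exp (a * k ^ β) (by positivity) n
  have h2 : k ≤ (k ^ β) ^ n := by
    rw [← Real.rpow_natCast, ← Real.rpow_mul (by linarith)]
    conv_lhs => rw [← Real.rpow_one k]
    exact Real.rpow_le_rpow_of_exponent_le hk hn
  rw [mul_pow, div_le_iff₀ (by positivity)] at h1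
  rw [Real.exp_neg, div_div, inv_eq_one_div, div_le_div_iff₀ (Real.exp_pos _) (by positivity),
    one_mul]
  calc a ^ n * k ≤ a ^ n * (k ^ β) ^ n := by gcongr
    _ ≤ _ := by linarith

/-- Half of the exponent is frozen at `K`, the other half is spent on a second factor `1/|k|`. The
powers of `2` in `B_β` come from this halving and from the two tails. -/
theorem norm_kernel_le_half {β : ℝ} (h0 : 0 < β) (h1 : β < 1) {K k : ℝ} (hK : 1 ≤ K)
    (hk : K ≤ |k|) :
    ‖kernel β k‖ ≤ Bβ β / 2 * Real.exp (-(Real.cos (β * Real.pi / 2) * K ^ β / 2))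
      * |k| ^ (-2 : ℝ) := by
  have hC := Cβ_pos β
  have hc := cos_pos h0 h1
  have hk0 : 0 < |k| := by linarith
  refine (norm_kernel_le_of_pos h0 h1 hk0).trans ?_
  have h2 := exp_neg_mul_rpow_le h0 (half_pos hc) (hK.trans hk)
  rw [Bβ]
  set c := Real.cos (β * Real.pi / 2)
  have h3 : Real.exp (-(c / 2 * |k| ^ β)) ≤ Real.exp (-(c * K ^ β / 2)) := by
    refine Real.exp_le_exp.2 ?_
    have : K ^ β ≤ |k| ^ β := by gcongr
    nlinarith
  rw [show -(c * |k| ^ β) = -(c / 2 * |k| ^ β) + -(c / 2 * |k| ^ β) by ring, Real.exp_add,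
    Real.rpow_neg hk0.le, Real.rpow_two]
  calc _ ≤ Real.exp (-(c * K ^ β / 2)) * ((Nat.factorial ⌈1 / β⌉₊ : ℝ) / (c / 2) ^ ⌈1 / β⌉₊ / |k|)
        / (Cβ β * |k|) := by gcongr
    _ = _ := by
      rw [div_pow, pow_succ]
      field_simp

theorem norm_kernel_le_of_one_le {β : ℝ} (h0 : 0 < β) (h1 : β < 1) {k : ℝ} (hk : 1 ≤ |k|) :
    ‖kernel β k‖ ≤ (Nat.factorial ⌈1 / β⌉₊ : ℝ)
      / (Cβ β * Real.cos (β * Real.pi / 2) ^ ⌈1 / β⌉₊) * |k| ^ (-2 : ℝ) := by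
  have hC := Cβ_pos β
  have hc := cos_pos h0 h1
  have hk0 : 0 < |k| := by linarith
  refine (norm_kernel_le_of_pos h0 h1 hk0).trans ?_
  have h2 := exp_neg_mul_rpow_le h0 hc hk
  rw [Real.rpow_neg hk0.le, Real.rpow_two]
  calc _ ≤ ((Nat.factorial ⌈1 / β⌉₊ : ℝ) / Real.cos (β * Real.pi / 2) ^ ⌈1 / β⌉₊ / |k|)
        / (Cβ β * |k|) := by gcongr
    _ = _ := by field_simp

theorem one_le_factorial_div {β : ℝ} (h0 : 0 < β) (h1 : β < 1) :
    1 / Cβ β ≤ (Nat.factorial ⌈1 / β⌉₊ : ℝ)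
      / (Cβ β * Real.cos (β * Real.pi / 2) ^ ⌈1 / β⌉₊) := by
  have hC := Cβ_pos β
  have hc := cos_pos h0 h1
  have h2 : (1 : ℝ) ≤ (Nat.factorial ⌈1 / β⌉₊ : ℝ) := by
    exact_mod_cast Nat.one_le_iff_ne_zero.2 (Nat.factorial_ne_zero _)
  have h3 : Real.cos (β * Real.pi / 2) ^ ⌈1 / β⌉₊ ≤ 1 := pow_le_one₀ hc.le (Real.cos_le_one _)
  rw [div_le_div_iff₀ hC (by positivity)]
  nlinarith [mul_le_mul_of_nonneg_left h3 hC.le, mul_le_mul_of_nonneg_left h2 hC.le]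

theorem norm_kernel_le_inv_one_add_sq {β : ℝ} (h0 : 0 < β) (h1 : β < 1) (k : ℝ) :
    ‖kernel β k‖ ≤ 2 * ((Nat.factorial ⌈1 / β⌉₊ : ℝ)
      / (Cβ β * Real.cos (β * Real.pi / 2) ^ ⌈1 / β⌉₊)) * (1 + k ^ 2)⁻¹ := by
  have hC := Cβ_pos β
  have hc := cos_pos h0 h1
  have hD := one_le_factorial_div h0 h1
  set D := (Nat.factorial ⌈1 / β⌉₊ : ℝ) / (Cβ β * Real.cos (β * Real.pi / 2) ^ ⌈1 / β⌉₊)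
  have hD0 : 0 < D := lt_of_lt_of_le (by positivity) hD
  rw [← div_eq_mul_inv, le_div_iff₀ (by positivity)]
  rcases le_or_gt 1 |k| with hk | hk
  · have h2 := norm_kernel_le_of_one_le h0 h1 hk
    have hk2 : 1 ≤ k ^ 2 := by rw [← sq_abs]; nlinarith
    rw [Real.rpow_neg (abs_nonneg k), Real.rpow_two, sq_abs, ← div_eq_mul_inv,
      le_div_iff₀ (by linarith)] at h2
    nlinarith [norm_nonneg (kernel β k)]
  · have h2 := (norm_kernel_le_one_div h0 h1 k).trans hD
    have hk2 : k ^ 2 ≤ 1 := by rw [← sq_abs]; nlinarith [abs_nonneg k]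
    nlinarith [norm_nonneg (kernel β k)]

/-! ### Truncation of the integral -/

section Truncation

open MeasureTheory

theorem integrable_of_norm_le_kernel {E : Type*} [NormedAddCommGroup E] {β : ℝ} (h0 : 0 < β) (h1 : β < 1) {f : ℝ → E}
    (hf : Continuous f) {R : ℝ} (hR : 0 ≤ R) (hfR : ∀ k, ‖f k‖ ≤ ‖kernel β k‖ * R) :
    Integrable f := by
  refine ((integrable_inv_one_add_sq.const_mul (2 * ((Nat.factorial ⌈1 / β⌉₊ : ℝ)
      / (Cβ β * Real.cos (β * Real.pi / 2) ^ ⌈1 / β⌉₊)))).mul_const R).mono'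
    hf.aestronglyMeasurable (Filter.Eventually.of_forall fun k => (hfR k).trans ?_)
  gcongr
  exact norm_kernel_le_inv_one_add_sq h0 h1 k

variable {E : Type*} [NormedAddCommGroup E] [NormedSpace ℝ E]

theorem integral_Ioi_rpow_neg_two {K : ℝ} (hK : 0 < K) :
    ∫ k in Set.Ioi K, k ^ (-2 : ℝ) = 1 / K := by
  rw [integral_Ioi_rpow_of_lt (by norm_num) hK]
  norm_num
  rw [Real.rpow_neg_one]

theorem norm_integral_Ioi_le {f : ℝ → E} {K D : ℝ} (hK : 0 < K)
    (hfD : ∀ k, K < k → ‖f k‖ ≤ D * k ^ (-2 : ℝ)) : ‖∫ k in Set.Ioi K, f k‖ ≤ D / K := by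
  calc ‖∫ k in Set.Ioi K, f k‖ ≤ ∫ k in Set.Ioi K, D * k ^ (-2 : ℝ) :=
        norm_integral_le_of_norm_le ((integrableOn_Ioi_rpow_of_lt (by norm_num) hK).const_mul D)
          ((ae_restrict_iff' measurableSet_Ioi).2 (Filter.Eventually.of_forall hfD))
    _ = D / K := by rw [integral_const_mul, integral_Ioi_rpow_neg_two hK, mul_one_div]

theorem norm_integral_Ioi_truncLevel_le {β : ℝ} (h0 : 0 < β) (h1 : β < 1) {ε : ℝ} (hε : 0 < ε)
    {f : ℝ → E} (hf : Continuous f) {R : ℝ} (hR : 0 ≤ R)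
    (hfR : ∀ k, ‖f k‖ ≤ ‖kernel β k‖ * R) :
    ‖∫ k in Set.Ioi (truncLevel β ε), f k‖ ≤ ε / 2 * R := by
  obtain ⟨hK, hKeq⟩ := truncLevel_spec h0 h1 hε
  have hB := Bβ_pos h0 h1
  have hC := Cβ_pos β
  have hc := cos_pos h0 h1
  have hint := integrable_of_norm_le_kernel h0 h1 hf hR hfR
  set K := truncLevel β ε
  have hKβ : 0 < K ^ β := by positivity
  have hεeq : ε = Bβ β / ((K ^ β) ^ β * Real.exp (Real.cos (β * Real.pi / 2) * K ^ β / 2)) := by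
    rw [hKeq]; field_simp
  rcases le_or_gt 1 K with hK1 | hK1
  · refine (norm_integral_Ioi_le (D := Bβ β / 2
      * Real.exp (-(Real.cos (β * Real.pi / 2) * K ^ β / 2)) * R) hK fun k hk => ?_).trans ?_
    · have hka : |k| = k := abs_of_pos (by linarith)
      have := norm_kernel_le_half h0 h1 hK1 (k := k) (by rw [hka]; exact hk.le)
      rw [hka] at this
      refine (hfR k).trans ((mul_le_mul_of_nonneg_right this hR).trans (le_of_eq (by ring)))
    -- The tail carries `1/K`, while the equation for `K` carries `K^(β²)`; for `K ≥ 1` the exchange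
    -- is favourable.
    · have hKK : (K ^ β) ^ β ≤ K := by
        rw [← Real.rpow_mul hK.le]
        conv_rhs => rw [← Real.rpow_one K]
        exact Real.rpow_le_rpow_of_exponent_le hK1 (by nlinarith)
      rw [hεeq, Real.exp_neg]
      calc _ = Bβ β / (K * Real.exp (Real.cos (β * Real.pi / 2) * K ^ β / 2)) / 2 * R := by
            field_simp
        _ ≤ _ := by gcongr
  -- For `K < 1` the exchange fails, but then `ε` is large: the equation gives `ε ≥ B_β/2 ≥ 4D`,
  -- while `[K, 1]` and `[1, ∞)` cost at most `D` each.
  · set D := (Nat.factorial ⌈1 / β⌉₊ : ℝ) / (Cβ β * Real.cos (β * Real.pi / 2) ^ ⌈1 / β⌉₊) with hD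
    have hD1 : 1 / Cβ β ≤ D := one_le_factorial_div h0 h1
    have hsplit : ∫ k in Set.Ioi K, f k = (∫ k in K..1, f k) + ∫ k in Set.Ioi 1, f k :=
      (intervalIntegral.integral_interval_add_Ioi hint.integrableOn hint.integrableOn).symm
    have h2 : ‖∫ k in K..1, f k‖ ≤ D * R := by
      refine (intervalIntegral.norm_integral_le_of_norm_le_const (C := D * R)
        fun k _ => ?_).trans ?_
      · exact (hfR k).trans (mul_le_mul_of_nonneg_right
          ((norm_kernel_le_one_div h0 h1 k).trans hD1) hR)
      · rw [abs_of_pos (by linarith)]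
        have : 0 ≤ D * R := by positivity
        nlinarith
    have h3 : ‖∫ k in Set.Ioi (1 : ℝ), f k‖ ≤ D * R := by
      refine (norm_integral_Ioi_le (D := D * R) one_pos fun k hk => ?_).trans (by simp)
      have hka : |k| = k := abs_of_pos (by linarith)
      have := norm_kernel_le_of_one_le h0 h1 (k := k) (by rw [hka]; exact hk.le)
      rw [hka] at this
      refine (hfR k).trans ((mul_le_mul_of_nonneg_right this hR).trans (le_of_eq (by ring)))
    have hεD : 4 * D ≤ ε := by
      have hn : 2 ≤ ⌈1 / β⌉₊ := by
        rw [Nat.add_one_le_ceil_iff, lt_div_iff₀ h0]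
        push_cast
        linarith
      have hBD : Bβ β = 2 ^ (⌈1 / β⌉₊ + 1) * D := by rw [Bβ, hD]; ring
      have hB8 : 8 * D ≤ Bβ β := by
        rw [hBD]
        have : (2 : ℝ) ^ 3 ≤ 2 ^ (⌈1 / β⌉₊ + 1) :=
          pow_le_pow_right₀ (by norm_num) (by omega)
        have hD0 : 0 ≤ D := by positivity
        nlinarith
      have hK2 : K ^ β ≤ 1 := Real.rpow_le_one hK.le hK1.le h0.le
      have hK3 : (K ^ β) ^ β ≤ 1 := Real.rpow_le_one hKβ.le hK2 h0.le
      have hK4 : Real.exp (Real.cos (β * Real.pi / 2) * K ^ β / 2) ≤ 2 := by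
        have h5 : Real.cos (β * Real.pi / 2) * K ^ β / 2 ≤ 1 / 2 := by
          nlinarith [Real.cos_le_one (β * Real.pi / 2)]
        refine (Real.exp_le_exp.2 h5).trans ?_
        have h6 : Real.exp (1 / 2) * Real.exp (1 / 2) = Real.exp 1 := by
          rw [← Real.exp_add]; norm_num
        nlinarith [Real.exp_one_lt_d9, Real.exp_pos (1 / 2)]
      rw [hεeq, le_div_iff₀ (by positivity)]
      calc 4 * D * ((K ^ β) ^ β * Real.exp (Real.cos (β * Real.pi / 2) * K ^ β / 2))
          ≤ 4 * D * (1 * 2) := by gcongr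
        _ ≤ Bβ β := by linarith
    rw [hsplit]
    refine (norm_add_le _ _).trans ((add_le_add h2 h3).trans ?_)
    nlinarith

theorem truncation_error {β : ℝ} (h0 : 0 < β) (h1 : β < 1) {ε : ℝ} (hε : 0 < ε)
    {f : ℝ → E} (hf : Continuous f) {R : ℝ} (hR : 0 ≤ R)
    (hfR : ∀ k, ‖f k‖ ≤ ‖kernel β k‖ * R) :
    ‖(∫ k in (-truncLevel β ε)..(truncLevel β ε), f k) - ∫ k, f k‖ ≤ ε * R := by
  have hint := integrable_of_norm_le_kernel h0 h1 hf hR hfR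
  have h2 := norm_integral_Ioi_truncLevel_le h0 h1 hε hf hR hfR
  have h3 := norm_integral_Ioi_truncLevel_le h0 h1 hε (f := fun k => f (-k)) (by fun_prop) hR
    fun k => (hfR (-k)).trans (mul_le_mul_of_nonneg_right (norm_kernel_neg β k).le hR)
  rw [integral_comp_neg_Ioi] at h3
  set K := truncLevel β ε
  have hsplit : ∫ k, f k
      = (∫ k in Set.Iic (-K), f k) + (∫ k in (-K)..K, f k) + ∫ k in Set.Ioi K, f k := by
    rw [← intervalIntegral.integral_Iic_add_Ioi (b := K) hint.integrableOn hint.integrableOn,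
      ← intervalIntegral.integral_Iic_sub_Iic hint.integrableOn hint.integrableOn]
    abel
  rw [hsplit, ← norm_neg]
  refine le_trans (le_of_eq ?_) ((norm_add_le _ _).trans ((add_le_add h3 h2).trans
    (le_of_eq (by ring))))
  congr 1
  abel

end Truncation

/-! ### A Cauchy integral formula for the lower half-plane -/

section HalfPlane

open MeasureTheory Filter Topology

variable {E : Type*} [NormedAddCommGroup E] [NormedSpace ℂ E]

/-- If `P` is holomorphic on a neighbourhood of the closed lower half-plane and `o(1 / |z|)` there,
its integrals over `[-R, R]` tend to zero. -/
theorem tendsto_integral_of_lower_half_plane {P : ℂ → E}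
    (hP : DifferentiableOn ℂ P {z | z.im < 1}) {b : ℝ → ℝ}
    (hb : ∀ R, 2 ≤ R → ∀ z : ℂ, z.im ≤ 0 → R ≤ ‖z‖ → ‖P z‖ ≤ b R)
    (hlim : Tendsto (fun R => R * b R) atTop (𝓝 0)) :
    Tendsto (fun R : ℝ => ∫ x in (-R)..R, P x) atTop (𝓝 0) := by
  have hbound : ∀ R : ℝ, 2 ≤ R → ‖∫ x in (-R)..R, P x‖ ≤ 4 * (R * b R) := by
    intro R hR
    -- On the rectangle `[-R, R] × [-R, 0]` the three other sides have total length `4R` and stay at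
    -- distance at least `R` from the origin.
    have hrect := Complex.integral_boundary_rect_eq_zero_of_differentiableOn P
      ⟨-R, -R⟩ ⟨R, 0⟩ (hP.mono fun z hz => by
        rw [Complex.mem_reProdIm, Set.uIcc_of_le (show (-R : ℝ) ≤ 0 by linarith)] at hz
        have := hz.2.2
        simp only [Set.mem_ofPred_eq]
        linarith)
    simp only [Complex.ofReal_zero, zero_mul, add_zero] at hrect
    have h1 : ‖∫ x in (-R)..R, P (x + (-R : ℝ) * Complex.I)‖ ≤ b R * |R - -R| := by
      refine intervalIntegral.norm_integral_le_of_norm_le_const fun x _ => hb R hR _ ?_ ?_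
      · simp; linarith
      · refine le_trans ?_ (Complex.abs_im_le_norm _)
        simp [abs_of_nonneg (show 0 ≤ R by linarith)]
    have h2 : ∀ a : ℝ, |a| = R → ‖∫ y in (-R)..0, P (a + y * Complex.I)‖ ≤ b R * |0 - -R| := by
      intro a ha
      refine intervalIntegral.norm_integral_le_of_norm_le_const fun y hy => hb R hR _ ?_ ?_
      · rw [Set.uIoc_of_le (by linarith)] at hy
        simpa using hy.2
      · refine le_trans ?_ (Complex.abs_re_le_norm _)
        simp [ha]
    have h3 := h2 R (abs_of_nonneg (by linarith))
    have h4 := h2 (-R) (by rw [abs_neg]; exact abs_of_nonneg (by linarith))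
    have heq : ∫ x in (-R)..R, P x = (∫ x in (-R)..R, P (x + (-R : ℝ) * Complex.I))
        + Complex.I • (∫ y in (-R)..0, P ((R : ℝ) + y * Complex.I))
        - Complex.I • ∫ y in (-R)..0, P ((-R : ℝ) + y * Complex.I) := by
      rw [← sub_eq_zero, ← neg_eq_zero, ← hrect]
      abel
    rw [heq]
    refine (norm_sub_le _ _).trans ((add_le_add_left (norm_add_le _ _) _).trans ?_)
    rw [norm_smul, norm_smul, Complex.norm_I, one_mul, one_mul]
    rw [sub_neg_eq_add, abs_of_nonneg (by linarith)] at h1 h3 h4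
    linarith
  refine squeeze_zero_norm' (a := fun R => 4 * (R * b R)) ?_ (by simpa using hlim.const_mul 4)
  filter_upwards [eventually_ge_atTop 2] with R hR using hbound R hR

/-- Subtracting `-2i/(z - i) · G(-i)` from `G` cancels the value at `-i`, so division by `z + i`
leaves a holomorphic function. The subtracted term has its pole in the upper half-plane and decays,
so the quotient is `o(1/|z|)` although `G` has no prescribed rate. -/
theorem integral_half_plane [CompleteSpace E] {G : ℂ → E} (hG : DifferentiableOn ℂ G {z | z.im < 1}) {η : ℝ → ℝ}
    (hη : ∀ R, 0 ≤ R → ∀ z : ℂ, z.im ≤ 0 → R ≤ ‖z‖ → ‖G z‖ ≤ η R)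
    (hlim : Tendsto η atTop (𝓝 0))
    (hint : Integrable fun x : ℝ => (1 - Complex.I * x)⁻¹ • G x) :
    ∫ x : ℝ, (1 - Complex.I * x)⁻¹ • G x = (2 * Real.pi : ℂ) • G (-Complex.I) := by
  set v := G (-Complex.I) with hv
  set S : Set ℂ := {z | z.im < 1} with hS
  have hSo : IsOpen S := isOpen_lt Complex.continuous_im continuous_const
  let N : ℂ → E := fun z => G z - (-2 * Complex.I / (z - Complex.I)) • v
  have hsub : ∀ z ∈ S, z - Complex.I ≠ 0 := fun z hz h => by
    rw [sub_eq_zero] at h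
    simp [hS, h] at hz
  have hN : DifferentiableOn ℂ N S := by
    refine hG.sub (DifferentiableOn.smul_const (fun z hz => ?_) v)
    have h1 : DifferentiableAt ℂ (fun z : ℂ => z - Complex.I) z := by fun_prop
    exact ((differentiableAt_const _).div h1 (hsub z hz)).differentiableWithinAt
  have hN0 : N (-Complex.I) = 0 := by
    have : (-2 * Complex.I / (-Complex.I - Complex.I)) = 1 := by
      rw [div_eq_one_iff_eq]
      · ring
      · intro h
        have := congrArg Complex.im h
        norm_num at this
    simp only [N, this, one_smul, hv, sub_self]
  have hP : DifferentiableOn ℂ (dslope N (-Complex.I)) S :=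
    (Complex.differentiableOn_dslope (hSo.mem_nhds (by simp [hS]))).2 hN
  have hPeq : ∀ z : ℂ, z ≠ -Complex.I →
      dslope N (-Complex.I) z = (z + Complex.I)⁻¹ • N z := fun z hz => by
    rw [dslope_of_ne _ hz, slope_def_module, hN0, sub_zero, sub_neg_eq_add]
  have hb : ∀ R : ℝ, 2 ≤ R → ∀ z : ℂ, z.im ≤ 0 → R ≤ ‖z‖ →
      ‖dslope N (-Complex.I) z‖ ≤ (R - 1)⁻¹ * (η R + 2 / (R - 1) * ‖v‖) := by
    intro R hR z hz hRz
    have h1 : R - 1 ≤ ‖z + Complex.I‖ := by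
      have := norm_sub_norm_le z (-Complex.I)
      rw [norm_neg, Complex.norm_I, sub_neg_eq_add] at this
      linarith
    have h2 : R - 1 ≤ ‖z - Complex.I‖ := by
      have := norm_sub_norm_le z Complex.I
      rw [Complex.norm_I] at this
      linarith
    have hR1 : 0 < R - 1 := by linarith
    rw [hPeq z (fun h => by rw [h, norm_neg, Complex.norm_I] at hRz; linarith), norm_smul, norm_inv]
    have h3 : ‖N z‖ ≤ η R + 2 / (R - 1) * ‖v‖ := by
      refine (norm_sub_le _ _).trans (add_le_add (hη R (by linarith) z hz hRz) ?_)
      rw [norm_smul, norm_div, norm_mul, Complex.norm_I, norm_neg]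
      simp only [Complex.norm_ofNat, mul_one]
      gcongr
    gcongr
  have hRlim : Tendsto (fun R : ℝ => R * (R - 1)⁻¹) atTop (𝓝 1) := by
    have h1 : Tendsto (fun R : ℝ => 1 + (R - 1)⁻¹) atTop (𝓝 (1 + 0)) :=
      (tendsto_inv_atTop_zero.comp (tendsto_atTop_add_const_right _ (-1) tendsto_id)).const_add 1
    rw [add_zero] at h1
    refine h1.congr' ?_
    filter_upwards [eventually_gt_atTop 1] with R hR
    have : R - 1 ≠ 0 := by linarith
    field_simp
    ring
  have hinv : Tendsto (fun R : ℝ => (R - 1)⁻¹) atTop (𝓝 0) :=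
    tendsto_inv_atTop_zero.comp (tendsto_atTop_add_const_right _ (-1) tendsto_id)
  have hmain := tendsto_integral_of_lower_half_plane hP hb (by
    have h1 := hRlim.mul (hlim.add ((hinv.const_mul 2).mul_const ‖v‖))
    simp only [mul_zero, zero_mul, add_zero] at h1
    refine h1.congr fun R => ?_
    rw [div_eq_mul_inv]
    ring)
  -- On the real line the correction is a multiple of `1/(1 + x²)`, whose integral `π` produces the
  -- value `2π G(-i)`.
  have hreal : ∀ x : ℝ, dslope N (-Complex.I) x
      = -Complex.I • ((1 - Complex.I * x)⁻¹ • G x)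
        + ((2 * Complex.I) • (((1 + x ^ 2)⁻¹ : ℝ) • v)) := by
    intro x
    have hne : (x : ℂ) ≠ -Complex.I := fun h => by
      have := congrArg Complex.im h
      simp at this
    have h1 : (x : ℂ) + Complex.I ≠ 0 := fun h => hne (by linear_combination h)
    have h2 : (x : ℂ) - Complex.I ≠ 0 := hsub x (by simp [hS])
    have h3 : (1 - Complex.I * x : ℂ) = -Complex.I * (x + Complex.I) := by
      linear_combination Complex.I_mul_I
    have h4 : ((1 + x ^ 2 : ℝ) : ℂ) = (x + Complex.I) * (x - Complex.I) := by
      push_cast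
      linear_combination Complex.I_mul_I
    rw [hPeq _ hne, ← Complex.coe_smul, Complex.ofReal_inv, h4, h3]
    simp only [N]
    rw [smul_sub, smul_smul, smul_smul, smul_smul, sub_eq_add_neg, ← neg_smul]
    congr 2
    · rw [mul_inv, ← mul_assoc, mul_inv_cancel₀ (neg_ne_zero.2 Complex.I_ne_zero), one_mul]
    · field_simp
  have hintv : Integrable fun x : ℝ => ((1 + x ^ 2)⁻¹ : ℝ) • v :=
    integrable_inv_one_add_sq.smul_const v
  have hintP : Integrable fun x : ℝ => dslope N (-Complex.I) (x : ℂ) := by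
    simp only [hreal]
    exact (hint.smul (-Complex.I)).add (hintv.smul (2 * Complex.I))
  have hzero : ∫ x : ℝ, dslope N (-Complex.I) (x : ℂ) = 0 :=
    tendsto_nhds_unique (intervalIntegral_tendsto_integral hintP tendsto_neg_atTop_atBot
      tendsto_id) hmain
  simp only [hreal] at hzero
  rw [integral_add (f := fun x : ℝ => -Complex.I • ((1 - Complex.I * x)⁻¹ • G x))
    (g := fun x : ℝ => (2 * Complex.I) • (((1 + x ^ 2)⁻¹ : ℝ) • v))
    (hint.smul (-Complex.I)) (hintv.smul (2 * Complex.I)), integral_smul, integral_smul,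
    integral_smul_const, integral_univ_inv_one_add_sq] at hzero
  have h5 : ∫ x : ℝ, (1 - Complex.I * x)⁻¹ • G x
      = Complex.I • (-Complex.I • ∫ x : ℝ, (1 - Complex.I * x)⁻¹ • G x) := by
    rw [smul_smul, mul_neg, Complex.I_mul_I, neg_neg, one_smul]
  rw [h5, eq_neg_of_add_eq_zero_left hzero, smul_neg, smul_smul, ← Complex.coe_smul, smul_smul,
    ← neg_smul]
  congr 1
  linear_combination (-2 * Real.pi : ℂ) * Complex.I_mul_I

end HalfPlane

/-! ### The propagator -/

section Propagator

open NormedSpace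

variable {E : Type*} [NormedAddCommGroup E] [InnerProductSpace ℂ E] [CompleteSpace E]

theorem hasDerivAt_exp_smul_apply (T : E →L[ℂ] E) (x : E) (τ : ℝ) :
    HasDerivAt (fun τ : ℝ => exp (τ • T) x) (T (exp (τ • T) x)) τ := by
  have h := hasDerivAt_exp_smul_const' (𝕂 := ℝ) T τ
  exact (((ContinuousLinearMap.apply ℂ E x).restrictScalars ℝ).hasFDerivAt).comp_hasDerivAt τ h

/-- If `Re ⟪x, T x⟫ ≤ ω ‖x‖²` for all `x`, then `‖exp T x‖ ≤ exp ω ‖x‖`. -/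
theorem norm_exp_apply_le {T : E →L[ℂ] E} {ω : ℝ}
    (hT : ∀ x, (inner ℂ x (T x)).re ≤ ω * ‖x‖ ^ 2) (x : E) :
    ‖exp T x‖ ≤ Real.exp ω * ‖x‖ := by
  let y : ℝ → E := fun τ => exp (τ • T) x
  have hy : ∀ τ, HasDerivAt y (T (y τ)) τ := hasDerivAt_exp_smul_apply T x
  have hn : ∀ τ, HasDerivAt (fun τ => ‖y τ‖ ^ 2) (2 * (inner ℂ (y τ) (T (y τ))).re) τ := by
    intro τ
    have h1 : HasDerivAt (fun τ => (inner ℂ (y τ) (y τ)).re)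
        ((inner ℂ (y τ) (T (y τ)) + inner ℂ (T (y τ)) (y τ)).re) τ :=
      (Complex.reCLM.hasFDerivAt).comp_hasDerivAt τ ((hy τ).inner ℂ (hy τ))
    have h2 : ∀ z : E, (inner ℂ z z).re = ‖z‖ ^ 2 := fun z => by
      rw [inner_self_eq_norm_sq_to_K]; norm_cast
    simp only [h2] at h1
    refine h1.congr_deriv ?_
    rw [Complex.add_re, ← inner_conj_symm (T (y τ)), Complex.conj_re]
    ring
  -- Gronwall: the derivative of `‖y‖²` is at most `2ω‖y‖²`.
  have hanti : Antitone fun τ => Real.exp (-(2 * ω) * τ) * ‖y τ‖ ^ 2 := by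
    have he : ∀ τ, HasDerivAt (fun τ => Real.exp (-(2 * ω) * τ))
        (Real.exp (-(2 * ω) * τ) * (-(2 * ω))) τ := fun τ =>
      (((hasDerivAt_id' τ).const_mul (-(2 * ω))).exp).congr_deriv (by ring)
    refine antitone_of_deriv_nonpos
      (fun τ => ((he τ).fun_mul (hn τ)).differentiableAt) fun τ => ?_
    rw [((he τ).fun_mul (hn τ)).deriv]
    have := hT (y τ)
    have := Real.exp_pos (-(2 * ω) * τ)
    nlinarith
  have h01 := hanti zero_le_one
  simp only [y, zero_smul, one_smul, exp_zero, mul_zero, Real.exp_zero, one_mul, mul_one,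
    one_apply_eq_self] at h01
  rw [← abs_of_nonneg (norm_nonneg (exp T x)),
    ← abs_of_nonneg (show 0 ≤ Real.exp ω * ‖x‖ by positivity), ← sq_le_sq, mul_pow,
    ← Real.exp_nat_mul]
  have h2 : Real.exp (-(2 * ω)) * Real.exp ((2 : ℕ) * ω) = 1 := by
    rw [← Real.exp_add]; simp
  have h3 := mul_le_mul_of_nonneg_left h01 (Real.exp_pos ((2 : ℕ) * ω)).le
  calc ‖exp T x‖ ^ 2 = Real.exp (-(2 * ω)) * Real.exp ((2 : ℕ) * ω) * ‖exp T x‖ ^ 2 := by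
        rw [h2, one_mul]
    _ ≤ _ := by linarith

/-- The solution of `u' = -A u`. -/
theorem eq_exp_apply_of_hasDerivAt {A : E →L[ℂ] E} {u : ℝ → E}
    (hu : ∀ τ, HasDerivAt u (-(A (u τ))) τ) (t : ℝ) : u t = exp (t • -A) (u 0) := by
  let _ : NormedAlgebra ℚ (E →L[ℂ] E) := NormedAlgebra.restrictScalars ℚ ℂ _
  have hw : ∀ τ, HasDerivAt (fun τ => exp (τ • A) (u τ)) 0 τ := by
    intro τ
    have h1 := hasDerivAt_exp_smul_const (𝕂 := ℝ) A τ
    have h2 : HasDerivAt (fun τ => exp (τ • A) (u τ))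
        ((exp (τ • A) * A) (u τ) + exp (τ • A) (-(A (u τ)))) τ :=
      HasDerivAt.clm_apply (𝕜 := ℝ) (c := fun τ => (exp (τ • A)).restrictScalars ℝ)
        (c' := ((exp (τ • A) * A)).restrictScalars ℝ)
        (((ContinuousLinearMap.restrictScalarsL ℂ E E ℝ ℝ).hasFDerivAt).comp_hasDerivAt τ h1)
        (hu τ)
    refine h2.congr_deriv ?_
    rw [map_neg, mul_apply_eq_comp, add_neg_cancel]
  have hconst := is_const_of_deriv_eq_zero (fun τ => (hw τ).differentiableAt)
    (fun τ => (hw τ).deriv) t 0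
  simp only [zero_smul, exp_zero, one_apply_eq_self] at hconst
  rw [← hconst, ← mul_apply_eq_comp, smul_neg,
    ← exp_add_of_commute (Commute.neg_left rfl), neg_add_cancel, exp_zero,
    one_apply_eq_self]

/-- The generator `-i t (z a + b)`. -/
def gen (a b : E →L[ℂ] E) (t : ℝ) (z : ℂ) : E →L[ℂ] E :=
  (-(Complex.I * (t : ℂ))) • (z • a + b)

theorem differentiable_exp_gen_apply (a b : E →L[ℂ] E) (t : ℝ) (x : E) :
    Differentiable ℂ fun z => exp (gen a b t z) x := by
  intro z
  have h1 : DifferentiableAt ℂ (gen a b t) z := by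
    unfold gen
    fun_prop
  have h2 : DifferentiableAt ℂ (exp : (E →L[ℂ] E) → (E →L[ℂ] E)) (gen a b t z) :=
    (exp_analytic (gen a b t z)).differentiableAt
  exact ((ContinuousLinearMap.apply ℂ E x).differentiableAt).comp z (h2.comp z h1)

omit [CompleteSpace E] in
theorem re_inner_gen {a b : E →L[ℂ] E} (ha : ∀ x, (inner ℂ x (a x)).im = 0)
    (hb : ∀ x, (inner ℂ x (b x)).im = 0) (t : ℝ) (z : ℂ) (x : E) :
    (inner ℂ x (gen a b t z x)).re = t * z.im * (inner ℂ x (a x)).re := by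
  simp only [gen, smul_apply, add_apply, inner_smul_right,
    inner_add_right]
  simp [ha x, hb x]
  ring

/-- Only a positive imaginary part lets the propagator grow. The case `r = 0` is the contraction
used on the real line and in the lower half-plane; `r = hs` serves the Cauchy discs. -/
theorem norm_exp_gen_apply_le {a b : E →L[ℂ] E} (ha : ∀ x, (inner ℂ x (a x)).im = 0)
    (hapos : ∀ x, 0 ≤ (inner ℂ x (a x)).re) (hb : ∀ x, (inner ℂ x (b x)).im = 0)
    {t : ℝ} (ht : 0 ≤ t) {r : ℝ} (hr : 0 ≤ r) {z : ℂ} (hz : z.im ≤ r) (x : E) :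
    ‖exp (gen a b t z) x‖ ≤ Real.exp (t * ‖a‖ * r) * ‖x‖ := by
  refine norm_exp_apply_le (fun y => ?_) x
  rw [re_inner_gen ha hb]
  have h1 : (inner ℂ y (a y)).re ≤ ‖a‖ * ‖y‖ ^ 2 := by
    refine (Complex.re_le_norm _).trans ((norm_inner_le_norm _ _).trans ?_)
    have := a.le_opNorm y
    nlinarith [norm_nonneg y]
  calc t * z.im * (inner ℂ y (a y)).re ≤ t * r * (inner ℂ y (a y)).re := by
        have := hapos y
        gcongr
    _ ≤ t * r * (‖a‖ * ‖y‖ ^ 2) := by gcongr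
    _ = _ := by ring

/-- The integrand of the LCHS formula. -/
def integrand (β : ℝ) (a b : E →L[ℂ] E) (t : ℝ) (x : E) (z : ℂ) : E :=
  kernelC β z • exp (gen a b t z) x

theorem differentiableOn_integrand (β : ℝ) (a b : E →L[ℂ] E) (t : ℝ) (x : E) :
    DifferentiableOn ℂ (integrand β a b t x) {z | |z.im| < 1} := fun z hz =>
  ((differentiableAt_kernelC hz).smul
    (differentiable_exp_gen_apply a b t x z)).differentiableWithinAt

theorem norm_integrand_ofReal_le {a b : E →L[ℂ] E} (ha : ∀ x, (inner ℂ x (a x)).im = 0)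
    (hapos : ∀ x, 0 ≤ (inner ℂ x (a x)).re) (hb : ∀ x, (inner ℂ x (b x)).im = 0)
    (β : ℝ) {t : ℝ} (ht : 0 ≤ t) (x : E) (k : ℝ) :
    ‖integrand β a b t x k‖ ≤ ‖kernel β k‖ * ‖x‖ := by
  rw [integrand, norm_smul, kernelC_ofReal]
  gcongr
  have := norm_exp_gen_apply_le ha hapos hb ht le_rfl (z := k) (by simp) x
  simpa using this

theorem continuous_integrand (β : ℝ) (a b : E →L[ℂ] E) (t : ℝ) (x : E) :
    Continuous fun k : ℝ => integrand β a b t x k :=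
  (differentiableOn_integrand β a b t x).continuousOn.comp_continuous Complex.continuous_ofReal
    fun k => by simp

/-- The LCHS formula: `∫ g(k) exp(-i t (k L + H)) dk = exp(-t (L + i H))`. -/
theorem integral_integrand {β : ℝ} (h0 : 0 < β) (h1 : β < 1) {a b : E →L[ℂ] E}
    (ha : ∀ x, (inner ℂ x (a x)).im = 0)
    (hapos : ∀ x, 0 ≤ (inner ℂ x (a x)).re) (hb : ∀ x, (inner ℂ x (b x)).im = 0)
    {t : ℝ} (ht : 0 ≤ t) (x : E) :
    ∫ k : ℝ, integrand β a b t x k = exp (t • -(a + Complex.I • b)) x := by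
  have hC := Cβ_pos β
  have hc := cos_pos h0 h1
  have heq : ∀ k : ℝ, integrand β a b t x k
      = (1 - Complex.I * k)⁻¹ • (kernelNum β k • exp (gen a b t k) x) := fun k => by
    rw [integrand, kernelC, smul_smul]
  have hint := integrable_of_norm_le_kernel h0 h1 (continuous_integrand β a b t x) (norm_nonneg x)
    (norm_integrand_ofReal_le ha hapos hb β ht x)
  simp only [heq] at hint ⊢
  have hmain := integral_half_plane (G := fun z => kernelNum β z • exp (gen a b t z) x)
    (η := fun R => Real.exp (-(Real.cos (β * Real.pi / 2) * R ^ β)) / Cβ β * ‖x‖)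
    (fun z hz => ((differentiableAt_kernelNum hz).smul
      (differentiable_exp_gen_apply a b t x z)).differentiableWithinAt)
    (fun R hR z hz hRz => by
      rw [norm_smul]
      have h2 := norm_exp_gen_apply_le ha hapos hb ht le_rfl hz x
      rw [mul_zero, Real.exp_zero, one_mul] at h2
      have h3 := norm_kernelNum_le h0 h1 hz hR hRz
      gcongr)
    (by
      have h2 : Filter.Tendsto (fun R : ℝ => Real.cos (β * Real.pi / 2) * R ^ β) Filter.atTop
          Filter.atTop := (tendsto_rpow_atTop h0).const_mul_atTop hc
      have h3 := ((Real.tendsto_exp_neg_atTop_nhds_zero.comp h2).div_const (Cβ β)).mul_const ‖x‖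
      simpa using h3)
    hint
  rw [hmain]
  -- At `z = -i` the base `1 + iz` is `2`, which explains `e^{-2^β}` in `C_β`.
  have hnum : kernelNum β (-Complex.I) = (1 / (2 * Real.pi) : ℝ) := by
    have h2 : (1 + Complex.I * -Complex.I : ℂ) = ((2 : ℝ) : ℂ) := by
      rw [mul_neg, Complex.I_mul_I]; norm_num
    rw [kernelNum, h2, ← Complex.ofReal_cpow (by norm_num), ← Complex.ofReal_neg,
      ← Complex.ofReal_exp, ← Complex.ofReal_div, Cβ]
    congr 1
    have := Real.exp_ne_zero (-(2 : ℝ) ^ β)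
    have := Real.pi_ne_zero
    field_simp
  have hgen : gen a b t (-Complex.I) = t • -(a + Complex.I • b) := by
    rw [gen, ← Complex.coe_smul, smul_neg, neg_smul, smul_add, smul_add, smul_smul, smul_smul,
      mul_neg, mul_right_comm, Complex.I_mul_I, neg_mul, one_mul, neg_neg, mul_comm Complex.I]
  rw [hnum, hgen, smul_smul]
  have : (2 * Real.pi : ℂ) * ((1 / (2 * Real.pi) : ℝ) : ℂ) = 1 := by
    have := Real.pi_ne_zero
    push_cast
    field_simp
  rw [this, one_smul]

end Propagator

/-! ### Matrices as operators -/

section Matrices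

variable {d : ℕ}

theorem op_exp (M : Matrix (Fin d) (Fin d) ℂ) :
    op (NormedSpace.exp M) = NormedSpace.exp (op M) := by
  -- An auxiliary norm: the exponential depends only on the topology.
  let _ : NormedRing (Matrix (Fin d) (Fin d) ℂ) := Matrix.linftyOpNormedRing
  let _ : NormedAlgebra ℂ (Matrix (Fin d) (Fin d) ℂ) := Matrix.linftyOpNormedAlgebra
  let _ : NormedAlgebra ℚ (Matrix (Fin d) (Fin d) ℂ) := NormedAlgebra.restrictScalars ℚ ℂ _
  let _ : NormedAlgebra ℚ (EuclideanSpace ℂ (Fin d) →L[ℂ] EuclideanSpace ℂ (Fin d)) :=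
    NormedAlgebra.restrictScalars ℚ ℂ _
  have hcont : Continuous (Matrix.toEuclideanCLM (n := Fin d) (𝕜 := ℂ)) :=
    LinearMap.continuous_of_finiteDimensional
      (Matrix.toEuclideanCLM (n := Fin d) (𝕜 := ℂ)).toAlgEquiv.toLinearMap
  exact NormedSpace.map_exp (Matrix.toEuclideanCLM (n := Fin d) (𝕜 := ℂ)) hcont M

theorem op_add (M N : Matrix (Fin d) (Fin d) ℂ) : op (M + N) = op M + op N :=
  map_add (Matrix.toEuclideanCLM (n := Fin d) (𝕜 := ℂ)) M N

theorem op_smul (c : ℂ) (M : Matrix (Fin d) (Fin d) ℂ) : op (c • M) = c • op M :=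
  map_smul (Matrix.toEuclideanCLM (n := Fin d) (𝕜 := ℂ)) c M

theorem op_evol (A : Matrix (Fin d) (Fin d) ℂ) (t k : ℝ) :
    op (evol A t k) = NormedSpace.exp (gen (op (hermPart A)) (op (skewPart A)) t k) := by
  rw [evol, op_exp, op_smul, op_add, op_smul, gen]

theorem hermPart_add_skewPart (A : Matrix (Fin d) (Fin d) ℂ) :
    hermPart A + Complex.I • skewPart A = A := by
  rw [hermPart, skewPart, smul_smul, show Complex.I * (1 / (2 * Complex.I)) = 1 / 2 by
    have := Complex.I_ne_zero
    field_simp, ← smul_add]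
  ext i j
  simp
  ring

theorem isHermitian_skewPart (A : Matrix (Fin d) (Fin d) ℂ) : (skewPart A).IsHermitian := by
  rw [Matrix.IsHermitian, skewPart, Matrix.conjTranspose_smul, Matrix.conjTranspose_sub,
    Matrix.conjTranspose_conjTranspose, ← neg_sub A, smul_neg, ← neg_smul]
  congr 1
  simp

theorem im_inner_op {M : Matrix (Fin d) (Fin d) ℂ} (hM : M.IsHermitian)
    (x : EuclideanSpace ℂ (Fin d)) : (inner ℂ x (op M x)).im = 0 := by
  have h1 : M.toEuclideanLin.IsSymmetric := Matrix.isSymmetric_toEuclideanLin_iff.2 hM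
  have h2 := h1.im_inner_self_apply x
  exact h2

theorem re_inner_op_nonneg {M : Matrix (Fin d) (Fin d) ℂ} (hM : M.PosSemidef)
    (x : EuclideanSpace ℂ (Fin d)) : 0 ≤ (inner ℂ x (op M x)).re := by
  have h1 : M.toEuclideanLin.IsPositive := Matrix.isPositive_toEuclideanLin_iff.2 hM
  exact h1.re_inner_nonneg_right x

theorem op_integrator_apply (A : Matrix (Fin d) (Fin d) ℂ) (t β h : ℝ) (n Q : ℕ)
    (x : EuclideanSpace ℂ (Fin d)) :
    op (integrator A t β h n Q) x = ∑ j ∈ terms n Q, (h / 2 * gaussWeight Q j.2) •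
      integrand β (op (hermPart A)) (op (skewPart A)) t x (point h j : ℝ) := by
  have h1 : op (integrator A t β h n Q)
      = ∑ j ∈ terms n Q, coeff β h Q j • op (evol A t (point h j)) := by
    rw [integrator, op, map_sum]
    exact Finset.sum_congr rfl fun j _ => op_smul _ _
  rw [h1, sum_apply]
  refine Finset.sum_congr rfl fun j _ => ?_
  rw [smul_apply, op_evol, coeff, integrand, kernelC_ofReal, ← smul_smul, Complex.coe_smul]

end Matrices

/-! ### The error of the discretized integrator -/

theorem card_terms {n Q : ℕ} (hQ : 1 ≤ Q) : ((terms n Q).card : ℝ) = 2 * n * Q := by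
  rw [terms, Finset.card_product, card_gaussNodes hQ, Int.card_Ico,
    show ((n : ℤ) - -n).toNat = 2 * n by omega]
  push_cast
  ring

theorem abs_point_le {n Q : ℕ} (hQ : 1 ≤ Q) {h : ℝ} (hh : 0 < h) {j : ℤ × ℝ}
    (hj : j ∈ terms n Q) : |point h j| ≤ n * h := by
  simp only [terms, Finset.mem_product, Finset.mem_Ico] at hj
  obtain ⟨⟨hm1, hm2⟩, hζ⟩ := hj
  obtain ⟨hζ1, hζ2⟩ := gaussNodes_subset hQ hζ
  have hm1' : -(n : ℝ) ≤ j.1 := by exact_mod_cast hm1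
  have hm2' : (j.1 : ℝ) + 1 ≤ n := by exact_mod_cast hm2
  rw [abs_le, point]
  constructor <;> nlinarith

/-- The free parameter `s` is the Cauchy radius in units of `h`. After the definition of `Q` has
been used, `hX` is all that the discretization still requires. -/
theorem integrator_error {d : ℕ} (A : Matrix (Fin d) (Fin d) ℂ) (hL : (hermPart A).PosSemidef)
    {t : ℝ} (ht : 0 < t) {β : ℝ} (h0 : 0 < β) (h1 : β < 1) {εtrunc εdisc : ℝ}
    (hεt : 0 < εtrunc) (hεd : 0 < εdisc)
    (hdom : -Real.exp (-1) ≤ quadArg β (truncLevel β εtrunc) εdisc)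
    {Q : ℕ} (hQ : Q = quadPoints β (truncLevel β εtrunc) εdisc) {h s : ℝ} {n : ℕ} (hh : 0 < h)
    (hs : 0 < s) (hn : truncLevel β εtrunc = n * h) (hhs : h * s < 1)
    (hX : Real.exp (-1) * Real.exp (t * ‖op (hermPart A)‖ * (h * s))
      / ((1 - h * s) * s ^ (2 * Q)) ≤ (2 * Q + 1) * (Real.pi * Real.exp (1 / 3) / 3))
    {u : ℝ → EuclideanSpace ℂ (Fin d)} (hu : ∀ τ, HasDerivAt u (-(op A (u τ))) τ) {εv : ℝ}
    (hεv : ‖u 0‖ * (εtrunc + εdisc) ≤ εv) :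
    ‖op (integrator A t β h n Q) (u 0) - u t‖ ≤ εv := by
  set a := op (hermPart A)
  set b := op (skewPart A)
  have ha : ∀ x, (inner ℂ x (a x)).im = 0 := im_inner_op hL.1
  have hapos : ∀ x, 0 ≤ (inner ℂ x (a x)).re := re_inner_op_nonneg hL
  have hb : ∀ x, (inner ℂ x (b x)).im = 0 := im_inner_op (isHermitian_skewPart A)
  have hC := Cβ_pos β
  obtain ⟨hK, -⟩ := truncLevel_spec h0 h1 hεt
  obtain ⟨hQ1, hQε⟩ := quadPoints_spec hK hεd hdom
  rw [← hQ] at hQ1 hQε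
  set f := integrand β a b t (u 0)
  have hsol : u t = ∫ k : ℝ, f k := by
    rw [integral_integrand h0 h1 ha hapos hb ht.le, eq_exp_apply_of_hasDerivAt hu t, ← op_smul,
      ← op_add, hermPart_add_skewPart]
  have htrunc := truncation_error h0 h1 hεt (continuous_integrand β a b t (u 0))
    (norm_nonneg (u 0)) (norm_integrand_ofReal_le ha hapos hb β ht.le (u 0))
  have him : ∀ (x : ℝ) (z : ℂ), dist z x ≤ h * s → |z.im| ≤ h * s := fun x z hz => by
    rw [dist_eq_norm] at hz
    have := Complex.abs_im_le_norm (z - x)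
    rw [Complex.sub_im, Complex.ofReal_im, sub_zero] at this
    exact this.trans hz
  have hopen : IsOpen {z : ℂ | |z.im| < 1} :=
    isOpen_lt (Complex.continuous_im.abs) continuous_const
  have hdisc := composite_error hQ1 (f := f) (U := {z | |z.im| < 1}) hopen
    (differentiableOn_integrand β a b t (u 0))
    (fun x => by simp) hh hs
    (fun x z hz => (him x z (Metric.mem_closedBall.1 hz)).trans_lt hhs)
    (B := Real.exp (-1) / (Cβ β * (1 - h * s)) * (Real.exp (t * ‖a‖ * (h * s)) * ‖u 0‖))
    (fun x z hz => by
      have hz' := him x z (Metric.mem_sphere.1 hz).le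
      have h2 := norm_kernelC_le h0 h1 hhs hz'
      have h3 := norm_exp_gen_apply_le ha hapos hb ht.le (by positivity)
        ((le_abs_self _).trans hz') (u 0)
      rw [show f z = kernelC β z • NormedSpace.exp (gen a b t z) (u 0) from rfl, norm_smul]
      gcongr) n
  have hbound : n * h * (Real.exp (-1) / (Cβ β * (1 - h * s))
      * (Real.exp (t * ‖a‖ * (h * s)) * ‖u 0‖) / s ^ (2 * Q)
        * (8 * Q / ((2 * Q + 1) * 16 ^ Q))) ≤ εdisc * ‖u 0‖ := by
    have h1hs : 0 < 1 - h * s := by linarith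
    calc _ = n * h * ‖u 0‖ * (8 * Q / (Cβ β * (2 * Q + 1) * 16 ^ Q))
          * (Real.exp (-1) * Real.exp (t * ‖a‖ * (h * s)) / ((1 - h * s) * s ^ (2 * Q))) := by
          field_simp
      _ ≤ n * h * ‖u 0‖ * (8 * Q / (Cβ β * (2 * Q + 1) * 16 ^ Q))
          * ((2 * Q + 1) * (Real.pi * Real.exp (1 / 3) / 3)) := by gcongr
      _ = truncLevel β εtrunc * (8 * Real.pi * Real.exp (1 / 3) * Q / (3 * Cβ β * 16 ^ Q))
          * ‖u 0‖ := by
          rw [hn]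
          field_simp
      _ ≤ _ := by gcongr
  rw [op_integrator_apply, hsol]
  rw [hn] at htrunc
  calc _ ≤ ‖(∑ j ∈ terms n Q, (h / 2 * gaussWeight Q j.2) • f (point h j : ℝ))
          - ∫ x in (-(n * h))..(n * h), f (x : ℝ)‖
        + ‖(∫ x in (-(n * h))..(n * h), f (x : ℝ)) - ∫ k : ℝ, f k‖ :=
        norm_sub_le_norm_sub_add_norm_sub _ _ _
    _ ≤ εdisc * ‖u 0‖ + εtrunc * ‖u 0‖ := add_le_add (hdisc.trans hbound) htrunc
    _ ≤ εv := by linarith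

/-! ### Numerical constants for the two step sizes -/

/-- Amounts to `1/e - 1/3 ≤ log(π/3)`, roughly `0.035 ≤ 0.046`. -/
theorem exp_exp_neg_one_le :
    Real.exp (Real.exp (-1)) ≤ Real.pi * Real.exp (1 / 3) / 3 := by
  have h1 : Real.exp (-1) ≤ 1 / 2.718 := by
    rw [Real.exp_neg, ← one_div]
    exact one_div_le_one_div_of_le (by norm_num) (by linarith [Real.exp_one_gt_d9])
  have h2 : Real.exp (0.04 : ℝ) ≤ 1 / 0.96 := by
    have := Real.add_one_le_exp (-0.04 : ℝ)
    rw [show (0.04 : ℝ) = -(-0.04) by norm_num, Real.exp_neg, ← one_div]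
    exact one_div_le_one_div_of_le (by norm_num) (by linarith)
  have h3 := Real.pi_gt_d2
  calc Real.exp (Real.exp (-1)) ≤ Real.exp (0.04 + 1 / 3) := by
        refine Real.exp_le_exp.2 (h1.trans ?_)
        norm_num
    _ = Real.exp 0.04 * Real.exp (1 / 3) := Real.exp_add _ _
    _ ≤ Real.pi / 3 * Real.exp (1 / 3) := by
        gcongr
        refine h2.trans ?_
        rw [le_div_iff₀ (by norm_num)]
        norm_num
        linarith
    _ = _ := by ring

/-- The constants of the discretization error for `h ≤ min(1, 1 / (e t ‖L‖))`. -/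
theorem small_step_bound {Q : ℕ} (hQ : 1 ≤ Q) {h l : ℝ} (hh : 0 < h) (hl : 0 ≤ l) (hh1 : h ≤ 1)
    (hhl : h * (Real.exp 1 * l) ≤ 1) {s : ℝ} (hs : s = 2 * Q / (2 * Q + 1)) :
    Real.exp (-1) * Real.exp (l * (h * s)) / ((1 - h * s) * s ^ (2 * Q))
      ≤ (2 * Q + 1) * (Real.pi * Real.exp (1 / 3) / 3) := by
  have hQ0 : (0 : ℝ) < Q := by exact_mod_cast hQ
  have hs0 : 0 < s := by rw [hs]; positivity
  have hs1 : s ≤ 1 := by rw [hs, div_le_one (by positivity)]; linarith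
  have h1 : 1 / (2 * (Q : ℝ) + 1) ≤ 1 - h * s := by
    have h2 : 1 - s = 1 / (2 * (Q : ℝ) + 1) := by rw [hs]; field_simp; ring
    nlinarith
  -- This is `(1 + 1/(2Q))^(2Q) ≤ e`; it cancels the `e^{-1}` of the kernel bound, while `1 - hs ≥
  -- 1/(2Q+1)` is paid for by the factor `2Q + 1`.
  have h2 : Real.exp (-1) ≤ s ^ (2 * Q) := by
    have h3 : Real.exp (-(1 / (2 * (Q : ℝ)))) ≤ s := by
      have := Real.add_one_le_exp (1 / (2 * (Q : ℝ)))
      rw [Real.exp_neg, hs, ← inv_div (2 * (Q : ℝ) + 1)]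
      refine inv_anti₀ (by positivity) ?_
      rw [add_div, div_self (by positivity)]
      linarith
    calc Real.exp (-1) = Real.exp (-(1 / (2 * (Q : ℝ)))) ^ (2 * Q) := by
          rw [← Real.exp_nat_mul]
          congr 1
          push_cast
          field_simp
      _ ≤ s ^ (2 * Q) := by gcongr
  have h3 : l * (h * s) ≤ Real.exp (-1) := by
    have h4 : l * h ≤ Real.exp (-1) := by
      rw [Real.exp_neg, inv_eq_one_div, le_div_iff₀ (Real.exp_pos 1)]
      linarith
    have : 0 ≤ l * h := by positivity
    nlinarith
  have h5 : (0 : ℝ) < 1 / (2 * (Q : ℝ) + 1) := by positivity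
  calc Real.exp (-1) * Real.exp (l * (h * s)) / ((1 - h * s) * s ^ (2 * Q))
      ≤ Real.exp (-1) * Real.exp (Real.exp (-1))
        / (1 / (2 * (Q : ℝ) + 1) * Real.exp (-1)) := by
        gcongr
        exact h5.le.trans h1
    _ = (2 * Q + 1) * Real.exp (Real.exp (-1)) := by
        have := Real.exp_ne_zero (-1)
        field_simp
    _ ≤ _ := by gcongr; exact exp_exp_neg_one_le

/-- The constants of the discretization error for `h ≤ t ‖L‖ h ≤ 4 / 5`. -/
theorem large_step_bound {Q : ℕ} (hQ : 1 ≤ Q) {h l : ℝ} (hl : 1 ≤ l) (hh : 0 < h)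
    (hhl : l * h ≤ 0.8) :
    Real.exp (-1) * Real.exp (l * (h * 1)) / ((1 - h * 1) * 1 ^ (2 * Q))
      ≤ (2 * Q + 1) * (Real.pi * Real.exp (1 / 3) / 3) := by
  have hQ1 : (1 : ℝ) ≤ Q := by exact_mod_cast hQ
  have hh8 : h ≤ 0.8 := by nlinarith
  rw [mul_one, one_pow, mul_one, ← Real.exp_add]
  have h1 : Real.exp (-1 + l * h) ≤ 1 / 1.2 := by
    have h2 : Real.exp (-1 + l * h) ≤ Real.exp (-0.2) :=
      Real.exp_le_exp.2 (by norm_num at hhl ⊢; linarith)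
    refine h2.trans ?_
    have := Real.add_one_le_exp (0.2 : ℝ)
    rw [Real.exp_neg, ← one_div]
    exact one_div_le_one_div_of_le (by norm_num) (by linarith)
  have h3 := Real.pi_gt_d2
  have h4 := Real.add_one_le_exp (1 / 3 : ℝ)
  have h5 : (0.2 : ℝ) ≤ 1 - h := by norm_num at hh8 ⊢; linarith
  calc Real.exp (-1 + l * h) / (1 - h) ≤ (1 / 1.2) / 0.2 := by gcongr
    _ ≤ 3 * (3.14 * (1 / 3 + 1) / 3) := by norm_num
    _ ≤ (2 * Q + 1) * (Real.pi * Real.exp (1 / 3) / 3) := by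
        gcongr
        linarith

/-- The choice of `n ≤ K e l / 2` panels per side. -/
theorem exists_panels {K l : ℝ} (hK : 9 ≤ K) (hl : 1 ≤ l) :
    ∃ n : ℕ, 0 < n ∧ 2 * (n : ℝ) ≤ l * Real.exp 1 * K ∧ l * (K / n) ≤ 0.8 := by
  have he := Real.exp_one_gt_d9
  -- The choice `n = ⌊x⌋` is the largest allowed by the bound on `M`. Since `K ≥ 9` gives `x ≥ 12`,
  -- rounding costs at most a factor `13/12`, and `(2/e)(13/12) < 0.8`.
  set x := l * Real.exp 1 * K / 2 with hx
  have hlK : 9 ≤ l * K := by nlinarith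
  have hx12 : 12 ≤ x := by rw [hx]; nlinarith
  have hn12 : 12 ≤ ⌊x⌋₊ := Nat.le_floor (by exact_mod_cast hx12)
  have hn12' : (12 : ℝ) ≤ ⌊x⌋₊ := by exact_mod_cast hn12
  have hfl := Nat.floor_le (show 0 ≤ x by linarith)
  have hlt := Nat.lt_floor_add_one x
  refine ⟨⌊x⌋₊, by omega, by rw [hx] at hfl ⊢; linarith, ?_⟩
  rw [mul_div_assoc', div_le_iff₀ (by linarith)]
  have h1 : l * K * 2.718 ≤ l * K * Real.exp 1 := by gcongr; linarith
  norm_num at h1 ⊢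
  nlinarith

end LCHS

end

/-! ### Proof of the two claims -/

theorem lemma3 {d : ℕ} (A : Matrix (Fin d) (Fin d) ℂ)
    (hL : (LCHS.hermPart A).PosSemidef)
    (t : ℝ) (ht : 0 < t) (β : ℝ) (hβ0 : 0 < β) (hβ1 : β < 1)
    (εtrunc εdisc : ℝ) (hεt : 0 < εtrunc) (hεd : 0 < εdisc)
    (K : ℝ) (hK : K = LCHS.truncLevel β εtrunc)
    (hdom : -Real.exp (-1) ≤ LCHS.quadArg β K εdisc)
    (Q : ℕ) (hQ : Q = LCHS.quadPoints β K εdisc) :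
    (∀ (h : ℝ) (n : ℕ), 0 < h → K = n * h → h ≤ 1 →
        h * (Real.exp 1 * t * ‖LCHS.op (LCHS.hermPart A)‖) ≤ 1 →
      ((LCHS.terms n Q).card : ℝ) = 2 * K * Q / h ∧
      (∀ j ∈ LCHS.terms n Q, |LCHS.point h j| ≤ K) ∧
      ∀ (u₀ : EuclideanSpace ℂ (Fin d)) (u : ℝ → EuclideanSpace ℂ (Fin d)) (εv : ℝ),
        (∀ τ, HasDerivAt u (-(LCHS.op A (u τ))) τ) → u 0 = u₀ →
        ‖u₀‖ * (εtrunc + εdisc) ≤ εv →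
        ‖LCHS.op (LCHS.integrator A t β h n Q) u₀ - u t‖ ≤ εv) ∧
    (1 ≤ t * ‖LCHS.op (LCHS.hermPart A)‖ → εtrunc ≤ 1 →
      ∃ (h : ℝ) (n : ℕ), 0 < h ∧ K = n * h ∧
        ((LCHS.terms n Q).card : ℝ) = 2 * K * Q / h ∧
        ((LCHS.terms n Q).card : ℝ) ≤ t * ‖LCHS.op (LCHS.hermPart A)‖ * Real.exp 1 * K * Q ∧
        (∀ j ∈ LCHS.terms n Q, |LCHS.point h j| ≤ K) ∧
        ∀ (u₀ : EuclideanSpace ℂ (Fin d)) (u : ℝ → EuclideanSpace ℂ (Fin d)) (εv : ℝ),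
          (∀ τ, HasDerivAt u (-(LCHS.op A (u τ))) τ) → u 0 = u₀ →
          ‖u₀‖ * (εtrunc + εdisc) ≤ εv →
          ‖LCHS.op (LCHS.integrator A t β h n Q) u₀ - u t‖ ≤ εv) := by

  subst hK
  obtain ⟨hKpos, -⟩ := LCHS.truncLevel_spec hβ0 hβ1 hεt
  have hQ1 : 1 ≤ Q := hQ ▸ (LCHS.quadPoints_spec hKpos hεd hdom).1
  constructor
  · intro h n hh hn hh1 hhl
    refine ⟨?_, fun j hj => ?_, ?_⟩
    · rw [LCHS.card_terms hQ1, hn]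
      field_simp
    · rw [hn]
      exact LCHS.abs_point_le hQ1 hh hj
    · rintro u₀ u εv hu rfl hεv
      have hQ0 : (0 : ℝ) < Q := by exact_mod_cast hQ1
      have hs1 : 2 * (Q : ℝ) / (2 * Q + 1) < 1 := by
        rw [div_lt_one (by positivity)]
        linarith
      -- As `h` may equal `1`, the radius `hs` must stay below `1`; this `s` balances `1/(1 - s)`
      -- against `s^(-2Q)`.
      refine LCHS.integrator_error A hL ht hβ0 hβ1 hεt hεd hdom hQ hh
        (s := 2 * Q / (2 * Q + 1)) (by positivity) hn ?_ ?_ hu hεv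
      · nlinarith
      · exact LCHS.small_step_bound hQ1 hh (by positivity) hh1 (by rw [← mul_assoc]; linarith) rfl
  · intro hl hεt1
    have hK9 := LCHS.nine_le_truncLevel hβ0 hβ1 hεt hεt1
    obtain ⟨n, hn, hn1, hn2⟩ := LCHS.exists_panels hK9 hl
    have hn0 : (0 : ℝ) < n := by exact_mod_cast hn
    set K := LCHS.truncLevel β εtrunc
    have hKn : K = n * (K / n) := by field_simp
    have hh : 0 < K / n := by positivity
    refine ⟨K / n, n, hh, hKn, ?_, ?_, fun j hj => ?_, ?_⟩
    · rw [LCHS.card_terms hQ1]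
      field_simp
    · rw [LCHS.card_terms hQ1]
      gcongr
    · exact (LCHS.abs_point_le hQ1 hh hj).trans_eq hKn.symm
    · rintro u₀ u εv hu rfl hεv
      -- Here `l ≥ 1` and `lh ≤ 0.8` force `h < 1`, so the full radius `h` fits in the strip and no
      -- power of `s` is lost.
      refine LCHS.integrator_error A hL ht hβ0 hβ1 hεt hεd hdom hQ hh (s := 1) one_pos hKn ?_
        (LCHS.large_step_bound hQ1 hl hh hn2) hu hεv
      norm_num at hn2
      nlinarith
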